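/- Fixed-design regression. Let $n\ge 1$, $a<b$, $x_1,\dots,x_n\in[a,b]$ (not necessarily distinct), let $Y_1,\dots,Y_n$ be independent integrable real random variables and $f^\star:[a,b]\to\mathbb R$ with $f^\star(x_i)=\mathbb E[Y_i]$. For $q\in[1,2]$ let $\sigma_q\in[0,+\infty]$ be any upper bound of $\bigl(n^{-1}\sum_{i=1}^n\mathbb E|Y_i-\mathbb E Y_i|^q\bigr)^{1/q}$. Put $\ell(f,g)=n^{-1}\sum_{i=1}^n|f(x_i)-g(x_i)|$ and $\ell(f,G)=\inf_{g\in G}\ell(f,g)$, with $\inf\varnothing=+\infty$. For a class $\mathcal F$ of real functions on $[a,b]$ and an integer $D\ge1$, let $\mathcal O(D)$ be the set of those $g\in\mathcal F$ for which the two classes of subsets $\{\{x\in\mathcal X_n: h(x)>g(x)\}: h\in\mathcal F\}$ and $\{\{x\in\mathcal X_n: h(x)<g(x)\}: h\in\mathcal F\}$ of $\mathcal X_n=\{x_1,\dots,x_n\}$ both have VC-dimension at most $D$. For a fixed constant $\kappa>0$, define the risk bound $$B_n(f^\star,\mathcal F)=\inf_{D\ge1}\Bigl\{3\,\ell(f^\star,\mathcal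 O(D))+\kappa\inf_{q\in[1,2]}\bigl[\sigma_q (D/n)^{1-1/q}\bigr]\Bigr\}.$$ Let $\mathcal C_1$ be the class of functions on $[a,b]$ that are continuous, monotone, and either convex or concave. Let $f'_r$ and $f'_l$ denote right and left derivatives, with values in $[-\infty,+\infty]$. A modulus of a Borel measure $\mu$ on $\mathbb R$ is a nonnegative, nondecreasing, concave function $w$ on $[0,+\infty)$ such that $\mu(I)\le w(\lambda(I))$ for every bounded interval $I\subset\mathbb R$, where $\lambda$ is the Lebesgue measure. **Corollary.** For every $\kappa>0$ there is a constant $C>0$, depending on $\kappa$ only, such that the following holds in the above setting whenever $f^\star\in\mathcal C_1$, $p\in[1,2]$ and $\sigma_p<+\infty$. Write $s=1-1/p$ and $V=|f^\star(a)-f^\star(b)|$, and use the convention $0^0=1$. (i) If $V'=|(f^\star)'_r(a)-(f^\star)'_l(b)|$ is finite, then $$B_n(f^\star,\mathcal C_1)\le C\Bigl[\sigma_p^{\frac{2}{s+2}}\Bigl(\frac{V'(b-a)}{n^2}\Bigr)^{\frac{s}{s+2}}+\frac{\sigma_p}{n^s}\Bigr].$$ (ii) If $Q=n^{-1}\sum_{i=1}^n\delta_{x_i}$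 has a modulus $w$ of the form $w(u)=w(0)+A\,(u/(b-a))^\alpha$ for $u\ge0$, with $A\ge1$ and $\alpha\in(0,1]$, then $$B_n(f^\star,\mathcal C_1)\le C\Bigl[\sigma_p^{\frac{\beta}{s+\beta}}\Bigl(\frac{c_\alpha(A)V}{n^\beta}\Bigr)^{\frac{s}{s+\beta}}+Vw(0)+\frac{\sigma_p}{n^s}\Bigr],$$ where $\beta=\frac{1+3\alpha}{1+\alpha}\in(1,2]$ and $c_\alpha(A)=(2^{1-\alpha}A/\alpha)^{1/(1+\alpha)}$. -/

import Mathlib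

open MeasureTheory ProbabilityTheory Filter Topology Set
open scoped ENNReal

noncomputable section

namespace ShapeRegression

/-- The VC-dimension of the class `𝒜` of subsets of `Y` is at most `D`: for every finite `B` with more
than `D` elements, some subset of `B` is not of the form `B ∩ A` with `A ∈ 𝒜`. -/
def VCDimLE {Y : Type*} (𝒜 : Set (Set Y)) (D : ℕ) : Prop :=
  ∀ B : Finset Y, D < B.card → ∃ S : Set Y, S ⊆ (B : Set Y) ∧ ∀ A ∈ 𝒜, (B : Set Y) ∩ A ≠ S

/-- `g` is extremal in the class `G` of functions on `Y`, with degree at most `D`. -/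
def IsExtremal {Y : Type*} (G : Set (Y → ℝ)) (g : Y → ℝ) (D : ℕ) : Prop :=
  g ∈ G ∧
    VCDimLE {A | ∃ h ∈ G, A = {y | g y < h y}} D ∧
    VCDimLE {A | ∃ h ∈ G, A = {y | h y < g y}} D

/-- `𝒪(D)`: the elements of `F` whose restriction to the set `{x 1, …, x n}` of design points is
extremal, with degree at most `D`, in the class of restrictions of the elements of `F`. -/
def extremalSet {n : ℕ} (x : Fin n → ℝ) (F : Set (ℝ → ℝ)) (D : ℕ) : Set (ℝ → ℝ) :=
  {g | g ∈ F ∧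
    IsExtremal ((fun (h : ℝ → ℝ) (y : range x) => h y) '' F) (fun y : range x => g y) D}

/-- The empirical `ℓ₁`-loss `ℓ(f, g) = n⁻¹ ∑ |f (x i) - g (x i)|`. -/
def loss {n : ℕ} (x : Fin n → ℝ) (f g : ℝ → ℝ) : ℝ :=
  (∑ i, |f (x i) - g (x i)|) / n

/-- `ℓ(f, G) = inf_{g ∈ G} ℓ(f, g)`, which is `+∞` when `G` is empty. -/
def lossToClass {n : ℕ} (x : Fin n → ℝ) (f : ℝ → ℝ) (G : Set (ℝ → ℝ)) : ℝ≥0∞ :=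
  ⨅ g ∈ G, ENNReal.ofReal (loss x f g)

/-- The risk bound
`B_n(f, F) = inf_{D ≥ 1} { 3 ℓ(f, 𝒪(D)) + κ inf_{p ∈ [1,2]} σ_p (D / n) ^ (1 - 1/p) }`. -/
def riskBound {n : ℕ} (κ : ℝ) (σ : ℝ → ℝ≥0∞) (x : Fin n → ℝ) (F : Set (ℝ → ℝ)) (f : ℝ → ℝ) :
    ℝ≥0∞ :=
  ⨅ (D : ℕ) (_ : 1 ≤ D),
    (3 * lossToClass x f (extremalSet x F D) +
      ENNReal.ofReal κ *
        ⨅ p ∈ Icc (1 : ℝ) 2, σ p * ENNReal.ofReal (((D : ℝ) / n) ^ (1 - 1 / p)))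

/-- Fixed-design regression: the `Y i` are independent and integrable, with means `f (x i)`. -/
structure IsRegressionModel {Ω : Type*} [MeasurableSpace Ω] (P : Measure Ω) {n : ℕ}
    (x : Fin n → ℝ) (f : ℝ → ℝ) (Y : Fin n → Ω → ℝ) : Prop where
  indep : iIndepFun Y P
  integrable : ∀ i, Integrable (Y i) P
  mean : ∀ i, ∫ ω, Y i ω ∂P = f (x i)

/-- `σ_p(x) = (n⁻¹ ∑ E |Y i - E (Y i)| ^ p) ^ (1/p) ∈ [0, +∞]`. -/
def errorMoment {Ω : Type*} [MeasurableSpace Ω] (P : Measure Ω) {n : ℕ} (Y : Fin n → Ω → ℝ)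
    (p : ℝ) : ℝ≥0∞ :=
  ((n : ℝ≥0∞)⁻¹ * ∑ i, ∫⁻ ω, ‖Y i ω - ∫ ω', Y i ω' ∂P‖ₑ ^ p ∂P) ^ (1 / p)

/-- The class `𝒞₁` on `[a, b]`: continuous, monotone, and either convex or concave functions. -/
def monoConvexConcave (a b : ℝ) : Set (ℝ → ℝ) :=
  {f | ContinuousOn f (Icc a b) ∧
    (MonotoneOn f (Icc a b) ∨ AntitoneOn f (Icc a b)) ∧
    (ConvexOn ℝ (Icc a b) f ∨ ConcaveOn ℝ (Icc a b) f)}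

/-- The right derivative of `f` at `a`, with values in `[-∞, +∞]`. For a function that is convex or
concave on some `[a, b]` with `a < b`, the upper limit below is a limit. -/
def rightDeriv (f : ℝ → ℝ) (a : ℝ) : EReal :=
  limsup (fun t : ℝ => (((f t - f a) / (t - a) : ℝ) : EReal)) (𝓝[>] a)

/-- The left derivative of `f` at `b`, with values in `[-∞, +∞]`. For a function that is convex or
concave on some `[a, b]` with `a < b`, the upper limit below is a limit. -/
def leftDeriv (f : ℝ → ℝ) (b : ℝ) : EReal :=
  limsup (fun t : ℝ => (((f t - f b) / (t - b) : ℝ) : EReal)) (𝓝[<] b)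

/-- `V' = |f'_r(a) - f'_l(b)| ∈ [0, +∞]`. -/
def derivVariation (f : ℝ → ℝ) (a b : ℝ) : ℝ≥0∞ :=
  (rightDeriv f a - leftDeriv f b).abs

/-- `w` is a modulus of `μ`: nonnegative, nondecreasing and concave on `[0, ∞)`, with
`μ I ≤ w (λ I)` for every bounded interval `I`. -/
structure IsModulus (μ : Measure ℝ) (w : ℝ → ℝ) : Prop where
  nonneg : ∀ u, 0 ≤ u → 0 ≤ w u
  mono : MonotoneOn w (Ici 0)
  concave : ConcaveOn ℝ (Ici 0) w
  le : ∀ I : Set ℝ, I.OrdConnected → Bornology.IsBounded I →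
    μ I ≤ ENNReal.ofReal (w (volume I).toReal)

/-- The empirical probability `Q = n⁻¹ ∑ δ_{x i}` of the design. -/
def designMeasure {n : ℕ} (x : Fin n → ℝ) : Measure ℝ :=
  (n : ℝ≥0∞)⁻¹ • ∑ i, Measure.dirac (x i)

/-- `c_α(A) = (2^{1-α} A / α)^{1/(1+α)}`. -/
def modulusConst (α A : ℝ) : ℝ := (2 ^ (1 - α) * A / α) ^ (1 / (1 + α))

/-- `β = (1 + 3α) / (1 + α)`. -/
def rateExponent (α : ℝ) : ℝ := (1 + 3 * α) / (1 + α)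

end ShapeRegression

end

namespace ShapeRegression

/-! The risk bound asks for extremal approximants of small degree. Relative to an affine function, a
convex or concave function cannot alternate below, above, below, above along four points, so a
member of the class that is affine on `m` pieces of the design is extremal with degree at most `3 *
m` (`isExtremal_of_piecewise_affine`). It remains to approximate a convex `f` by a maximum of `4 *
k` tangents with slopes of one sign; the concave case is the convex one for `-f`. The tangent at `u
≤ v` errs at `v` by at most (increment of slope) × (v - u). If the slopes vary by at most `V'`, a
net on which position and slope both have small increments gives the error `V' (b - a) / k ^ 2`
(`exists_net`, `affineApprox_of_subgradient`). In (ii) the slope may blow up at an endpoint, `b`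
say. It is replaced by the value at `b` of the tangent, which stays between `f a` and `f b`, and the
position by the square root of the relative distance `τ` to `b`. The error at `v` becomes `V / k`
times the minimum of `1` and `2 / (k √τ)`. The modulus says that few design points have small `τ`,
which bounds the mean error by `c_α(A) V / k ^ β` (`sum_error_le`), the atom `w 0` costing a further
multiple of `V * w 0`. Finally `k` balances `L / k ^ β` against `σ (k / n) ^ s`
(`le_of_forall_pieces`). -/

/-! ### Degree of piecewise affine functions. -/

lemma le_affine_of_convexOn {s : Set ℝ} {h : ℝ → ℝ} (hh : ConvexOn ℝ s h) {c d x y z : ℝ}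
    (hx : x ∈ s) (hz : z ∈ s) (hxy : x < y) (hyz : y < z) (h1 : h x ≤ c * x + d)
    (h3 : h z ≤ c * z + d) : h y ≤ c * y + d := by
  have := hh.secant_mono_aux1 hx hz hxy hyz
  have e1 := mul_le_mul_of_nonneg_left h1 (sub_nonneg.2 hyz.le)
  have e2 := mul_le_mul_of_nonneg_left h3 (sub_nonneg.2 hxy.le)
  have : (z - x) * h y ≤ (z - x) * (c * y + d) := by linarith
  exact le_of_mul_le_mul_left this (by linarith)

lemma lt_affine_of_convexOn {s : Set ℝ} {h : ℝ → ℝ} (hh : ConvexOn ℝ s h) {c d x y z : ℝ}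
    (hx : x ∈ s) (hz : z ∈ s) (hxy : x < y) (hyz : y < z) (h1 : h x < c * x + d)
    (h3 : h z < c * z + d) : h y < c * y + d := by
  have := hh.secant_mono_aux1 hx hz hxy hyz
  have e1 := mul_lt_mul_of_pos_left h1 (sub_pos.2 hyz)
  have e2 := mul_lt_mul_of_pos_left h3 (sub_pos.2 hxy)
  have : (z - x) * h y < (z - x) * (c * y + d) := by linarith
  exact lt_of_mul_lt_mul_left this (by linarith)

/-- If the design points are covered by `m` sets on each of which `g` is affine, then among more than
`3 m` of them there are four on the same affine piece. -/
lemma exists_four_on_piece {n : ℕ} {x : Fin n → ℝ} {g : ℝ → ℝ} {S : Finset (ℝ × ℝ)}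
    (hg : ∀ y ∈ range x, ∃ q ∈ S, g y = q.1 * y + q.2) {B : Finset (range x)}
    (hB : 3 * S.card < B.card) :
    ∃ (e : Fin 4 → range x) (q : ℝ × ℝ), StrictMono e ∧ (∀ i, e i ∈ B) ∧
      ∀ i, g (e i) = q.1 * (e i : ℝ) + q.2 := by
  choose! q hqS hq using hg
  obtain ⟨r, -, hr⟩ := Finset.exists_lt_card_fiber_of_mul_lt_card_of_maps_to
    (s := B) (t := S) (f := fun y : range x => q y) (n := 3) (fun y _ => hqS y y.2)
    (by rwa [mul_comm])
  have hr' : 4 ≤ (B.filter fun y : range x => q y = r).card := hr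
  refine ⟨Finset.orderEmbOfCardLe _ hr', r, (Finset.orderEmbOfCardLe _ hr').strictMono,
    fun i => ?_, fun i => ?_⟩
  · exact (Finset.mem_filter.1 (Finset.orderEmbOfCardLe_mem _ hr' i)).1
  · have := (Finset.mem_filter.1 (Finset.orderEmbOfCardLe_mem _ hr' i)).2
    rw [hq _ (Finset.orderEmbOfCardLe _ hr' i).2, this]

/-- A class that cannot pick out the second and fourth among four suitable points of each set with
more than `D` elements has VC-dimension at most `D`. -/
lemma vcDimLE_of_alternating {Y : Type*} [LinearOrder Y] {𝒜 : Set (Set Y)} {D : ℕ}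
    (h : ∀ B : Finset Y, D < B.card → ∃ e : Fin 4 → Y, StrictMono e ∧ (∀ i, e i ∈ B) ∧
      ∀ A ∈ 𝒜, ¬ (e 0 ∉ A ∧ e 1 ∈ A ∧ e 2 ∉ A ∧ e 3 ∈ A)) : VCDimLE 𝒜 D := by
  intro B hB
  obtain ⟨e, he, heB, hA⟩ := h B hB
  refine ⟨{e 1, e 3}, ?_, fun A hAA hEq => hA A hAA ?_⟩
  · rintro y (rfl | rfl)
    · exact heB 1
    · exact heB 3
  · have key : ∀ i, e i ∈ A ↔ i = 1 ∨ i = 3 := fun i => by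
      have : e i ∈ (B : Set Y) ∩ A ↔ e i ∈ ({e 1, e 3} : Set Y) := by rw [hEq]
      simpa [heB i, he.injective.eq_iff] using this
    simp [key]

lemma isExtremal_of_piecewise_affine {n : ℕ} {x : Fin n → ℝ} {a b : ℝ} (hx : ∀ i, x i ∈ Icc a b)
    {g : ℝ → ℝ} (hgC : g ∈ monoConvexConcave a b) {S : Finset (ℝ × ℝ)}
    (hg : ∀ y ∈ range x, ∃ q ∈ S, g y = q.1 * y + q.2) {D : ℕ} (hD : 3 * S.card ≤ D) :
    g ∈ extremalSet x (monoConvexConcave a b) D := by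
  have hmem : ∀ y : range x, (y : ℝ) ∈ Icc a b := by
    rintro ⟨_, i, rfl⟩; exact hx i
  refine ⟨hgC, ⟨g, hgC, rfl⟩, ?_, ?_⟩
  · refine vcDimLE_of_alternating fun B hB => ?_
    obtain ⟨e, q, he, heB, hq⟩ := exists_four_on_piece hg (hD.trans_lt hB)
    refine ⟨e, he, heB, ?_⟩
    rintro A ⟨_, ⟨h, hh, rfl⟩, rfl⟩
    simp only [mem_ofPred_eq, not_lt, hq]
    rintro ⟨h0, h1, h2, h3⟩
    have l01 : (e 0 : ℝ) < e 1 := he (by decide)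
    have l12 : (e 1 : ℝ) < e 2 := he (by decide)
    have l23 : (e 2 : ℝ) < e 3 := he (by decide)
    -- A convex `h` is refuted by the points 0, 1, 2 and a concave one by the points 1, 2, 3; for
    -- the sets where `h` is below `g` the roles are exchanged.
    rcases hh.2.2 with hv | hv
    · exact absurd (le_affine_of_convexOn hv (hmem _) (hmem _) l01 l12 h0 h2) (not_le.2 h1)
    · have := lt_affine_of_convexOn hv.neg (c := -q.1) (d := -q.2) (hmem (e 1)) (hmem (e 3)) l12 l23
        (by simp only [Pi.neg_apply]; linarith) (by simp only [Pi.neg_apply]; linarith)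
      simp only [Pi.neg_apply] at this
      linarith
  · refine vcDimLE_of_alternating fun B hB => ?_
    obtain ⟨e, q, he, heB, hq⟩ := exists_four_on_piece hg (hD.trans_lt hB)
    refine ⟨e, he, heB, ?_⟩
    rintro A ⟨_, ⟨h, hh, rfl⟩, rfl⟩
    simp only [mem_ofPred_eq, not_lt, hq]
    rintro ⟨h0, h1, h2, h3⟩
    have l01 : (e 0 : ℝ) < e 1 := he (by decide)
    have l12 : (e 1 : ℝ) < e 2 := he (by decide)
    have l23 : (e 2 : ℝ) < e 3 := he (by decide)
    rcases hh.2.2 with hv | hv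
    · exact absurd (lt_affine_of_convexOn hv (hmem _) (hmem _) l12 l23 h1 h3) (not_lt.2 h2)
    · have := le_affine_of_convexOn hv.neg (c := -q.1) (d := -q.2) (hmem (e 0)) (hmem (e 2))
        l01 l12 (by simp only [Pi.neg_apply]; linarith) (by simp only [Pi.neg_apply]; linarith)
      simp only [Pi.neg_apply] at this
      linarith

/-! ### Maxima of affine functions as approximants. -/

/-- The maximum of finitely many affine functions `t ↦ q.1 * t + q.2`. -/
noncomputable def affineMax (S : Finset (ℝ × ℝ)) (hS : S.Nonempty) (t : ℝ) : ℝ :=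
  S.sup' hS fun q => q.1 * t + q.2

lemma exists_affineMax_eq (S : Finset (ℝ × ℝ)) (hS : S.Nonempty) (t : ℝ) :
    ∃ q ∈ S, affineMax S hS t = q.1 * t + q.2 :=
  Finset.exists_mem_eq_sup' hS _

lemma le_affineMax {S : Finset (ℝ × ℝ)} (hS : S.Nonempty) (t : ℝ) {q : ℝ × ℝ} (hq : q ∈ S) :
    q.1 * t + q.2 ≤ affineMax S hS t :=
  Finset.le_sup' (fun q : ℝ × ℝ => q.1 * t + q.2) hq

lemma continuous_affineMax (S : Finset (ℝ × ℝ)) (hS : S.Nonempty) :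
    Continuous (affineMax S hS) :=
  Continuous.finset_sup'_apply hS fun q _ => by fun_prop

lemma convexOn_affineMax (S : Finset (ℝ × ℝ)) (hS : S.Nonempty) (s : Set ℝ) (hs : Convex ℝ s) :
    ConvexOn ℝ s (affineMax S hS) := by
  refine ⟨hs, fun u _ v _ r t hr ht hrt => ?_⟩
  refine Finset.sup'_le _ _ fun q hq => ?_
  have h1 := mul_le_mul_of_nonneg_left (le_affineMax hS u hq) hr
  have h2 := mul_le_mul_of_nonneg_left (le_affineMax hS v hq) ht
  simp only [smul_eq_mul]
  have : q.2 = r * q.2 + t * q.2 := by rw [← add_mul, hrt, one_mul]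
  linarith

lemma monotone_affineMax {S : Finset (ℝ × ℝ)} (hS : S.Nonempty) (h : ∀ q ∈ S, 0 ≤ q.1) :
    Monotone (affineMax S hS) := by
  intro u v huv
  refine Finset.sup'_le _ _ fun q hq => ?_
  have := mul_le_mul_of_nonneg_left huv (h q hq)
  linarith [le_affineMax hS v hq]

lemma antitone_affineMax {S : Finset (ℝ × ℝ)} (hS : S.Nonempty) (h : ∀ q ∈ S, q.1 ≤ 0) :
    Antitone (affineMax S hS) := by
  intro u v huv
  refine Finset.sup'_le _ _ fun q hq => ?_
  have := mul_le_mul_of_nonpos_left huv (h q hq)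
  linarith [le_affineMax hS u hq]

/-- The common sign of the slopes is what makes the maximum monotone, as membership in the class
demands. -/
lemma affineMax_mem {S : Finset (ℝ × ℝ)} (hS : S.Nonempty) (a b : ℝ)
    (h : (∀ q ∈ S, 0 ≤ q.1) ∨ ∀ q ∈ S, q.1 ≤ 0) : affineMax S hS ∈ monoConvexConcave a b :=
  ⟨(continuous_affineMax S hS).continuousOn,
    h.imp (fun h => (monotone_affineMax hS h).monotoneOn _)
      (fun h => (antitone_affineMax hS h).antitoneOn _),
    Or.inl (convexOn_affineMax S hS _ (convex_Icc a b))⟩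

lemma neg_mem_monoConvexConcave {a b : ℝ} {f : ℝ → ℝ} (hf : f ∈ monoConvexConcave a b) :
    -f ∈ monoConvexConcave a b :=
  ⟨hf.1.neg, hf.2.1.symm.imp (fun h => h.neg) (fun h => h.neg),
    hf.2.2.symm.imp (fun h => h.neg) (fun h => h.neg)⟩

/-- `f` is approximated from the design points, up to `ε` in mean, by a maximum of at most `m` affine
functions with slopes of a constant sign. -/
def AffineApprox {n : ℕ} (x : Fin n → ℝ) (f : ℝ → ℝ) (m : ℕ) (ε : ℝ) : Prop :=
  ∃ (S : Finset (ℝ × ℝ)) (hS : S.Nonempty), S.card ≤ m ∧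
    ((∀ q ∈ S, 0 ≤ q.1) ∨ ∀ q ∈ S, q.1 ≤ 0) ∧ loss x f (affineMax S hS) ≤ ε

lemma lossToClass_le_of_affineApprox {n : ℕ} {x : Fin n → ℝ} {a b : ℝ} (hx : ∀ i, x i ∈ Icc a b)
    {f : ℝ → ℝ} {m D : ℕ} {ε : ℝ} (h : AffineApprox x f m ε) (hD : 3 * m ≤ D) :
    lossToClass x f (extremalSet x (monoConvexConcave a b) D) ≤ ENNReal.ofReal ε := by
  obtain ⟨S, hS, hm, hsgn, hl⟩ := h
  refine (iInf₂_le (affineMax S hS) ?_).trans (ENNReal.ofReal_le_ofReal hl)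
  exact isExtremal_of_piecewise_affine hx (affineMax_mem hS a b hsgn)
    (fun y _ => exists_affineMax_eq S hS y) (by omega)

lemma lossToClass_le_of_affineApprox_neg {n : ℕ} {x : Fin n → ℝ} {a b : ℝ}
    (hx : ∀ i, x i ∈ Icc a b) {f : ℝ → ℝ} {m D : ℕ} {ε : ℝ} (h : AffineApprox x (-f) m ε)
    (hD : 3 * m ≤ D) :
    lossToClass x f (extremalSet x (monoConvexConcave a b) D) ≤ ENNReal.ofReal ε := by
  obtain ⟨S, hS, hm, hsgn, hl⟩ := h
  refine (iInf₂_le (-affineMax S hS) ?_).trans (ENNReal.ofReal_le_ofReal ?_)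
  · refine isExtremal_of_piecewise_affine hx (neg_mem_monoConvexConcave (affineMax_mem hS a b hsgn))
      (S := S.image fun q => (-q.1, -q.2)) (fun y _ => ?_)
      ((Nat.mul_le_mul_left 3 (Finset.card_image_le.trans hm)).trans hD)
    obtain ⟨q, hq, he⟩ := exists_affineMax_eq S hS y
    exact ⟨_, Finset.mem_image_of_mem _ hq, by simp only [Pi.neg_apply, he]; ring⟩
  · refine le_of_eq_of_le ?_ hl
    unfold loss
    congr 1
    refine Finset.sum_congr rfl fun i _ => ?_
    rw [← abs_neg]
    simp only [Pi.neg_apply]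
    ring_nf

/-- Reflection of the design. -/
lemma AffineApprox.of_reflect {n : ℕ} {x : Fin n → ℝ} {f : ℝ → ℝ} {m : ℕ} {ε : ℝ} (r : ℝ)
    (h : AffineApprox (fun i => r - x i) (fun t => f (r - t)) m ε) : AffineApprox x f m ε := by
  obtain ⟨S, hS, hm, hsgn, hl⟩ := h
  refine ⟨S.image fun q => (-q.1, q.1 * r + q.2), hS.image _, Finset.card_image_le.trans hm, ?_, ?_⟩
  · rcases hsgn with h | h
    · right
      intro q hq
      obtain ⟨p, hp, rfl⟩ := Finset.mem_image.1 hq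
      exact neg_nonpos.2 (h p hp)
    · left
      intro q hq
      obtain ⟨p, hp, rfl⟩ := Finset.mem_image.1 hq
      exact neg_nonneg.2 (h p hp)
  · refine le_of_eq_of_le ?_ hl
    unfold loss
    congr 1
    refine Finset.sum_congr rfl fun i _ => ?_
    have : affineMax (S.image fun q => (-q.1, q.1 * r + q.2)) (hS.image _) (x i) =
        affineMax S hS (r - x i) := by
      unfold affineMax
      rw [Finset.sup'_image]
      congr 1
      funext q
      simp only [Function.comp_apply]
      ring
    rw [this]
    simp

/-! ### Subgradients of convex functions. -/

/-- `c` is a subgradient of `f` at `u`, relative to `[a, b]`. -/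
def IsSubgradient (f : ℝ → ℝ) (a b u c : ℝ) : Prop :=
  ∀ y ∈ Icc a b, f u + c * (y - u) ≤ f y

lemma exists_isSubgradient {f : ℝ → ℝ} {a b u : ℝ} (hf : ConvexOn ℝ (Icc a b) f)
    (hu : u ∈ Ioo a b) : ∃ c, IsSubgradient f a b u c := by
  have hi : u ∈ interior (Icc a b) := by rwa [interior_Icc]
  have hu' := Ioo_subset_Icc_self hu
  refine ⟨derivWithin f (Ioi u) u, fun y hy => ?_⟩
  rcases lt_trichotomy y u with h | rfl | h
  · have h1 := (hf.slope_le_leftDeriv_of_mem_interior hy hi h).trans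
      (hf.leftDeriv_le_rightDeriv_of_mem_interior hi)
    rw [slope_def_field, div_le_iff₀ (by linarith)] at h1
    linarith
  · simp
  · have h1 := hf.rightDeriv_le_slope_of_mem_interior hi hy h
    rw [slope_def_field, le_div_iff₀ (by linarith)] at h1
    linarith

lemma IsSubgradient.le {f : ℝ → ℝ} {a b u v c d : ℝ} (hu : u ∈ Icc a b) (hv : v ∈ Icc a b)
    (hc : IsSubgradient f a b u c) (hd : IsSubgradient f a b v d) (huv : u < v) : c ≤ d := by
  have h1 := hc v hv
  have h2 := hd u hu
  have : 0 ≤ (d - c) * (v - u) := by linarith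
  by_contra hlt
  exact absurd this (not_le.2 (mul_neg_of_neg_of_pos (by linarith) (by linarith)))

lemma IsSubgradient.nonneg {f : ℝ → ℝ} {a b u c : ℝ} (hf : MonotoneOn f (Icc a b))
    (hu : u ∈ Icc a b) (hau : a < u) (hc : IsSubgradient f a b u c) : 0 ≤ c := by
  have ha : a ∈ Icc a b := ⟨le_rfl, hu.1.trans hu.2⟩
  have h1 := hc a ha
  have h2 := hf ha hu hu.1
  by_contra hlt
  have := mul_pos_of_neg_of_neg (not_le.1 hlt) (sub_neg.2 hau)
  linarith

lemma IsSubgradient.nonpos {f : ℝ → ℝ} {a b u c : ℝ} (hf : AntitoneOn f (Icc a b))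
    (hu : u ∈ Icc a b) (hub : u < b) (hc : IsSubgradient f a b u c) : c ≤ 0 := by
  have hb : b ∈ Icc a b := ⟨hu.1.trans hu.2, le_rfl⟩
  have h1 := hc b hb
  have h2 := hf hu hb hu.2
  by_contra hlt
  have := mul_pos (not_le.1 hlt) (sub_pos.2 hub)
  linarith

/-! ### Nets for two monotone functions. -/

/-- The index of the cell of `[lo, lo + M]`, cut into `k` cells, that contains `t`. -/
noncomputable def cellIndex (k : ℕ) (lo M t : ℝ) : ℕ := ⌊(k : ℝ) * ((t - lo) / M)⌋₊

lemma cellIndex_mono (k : ℕ) (lo : ℝ) {M t u : ℝ} (hM : 0 ≤ M) (h : t ≤ u) :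
    cellIndex k lo M t ≤ cellIndex k lo M u := by
  unfold cellIndex
  gcongr

lemma cellIndex_le (k : ℕ) {lo M t : ℝ} (hM : 0 ≤ M) (ht : t ≤ lo + M) :
    cellIndex k lo M t ≤ k := by
  unfold cellIndex
  refine Nat.floor_le_of_le ?_
  have : (t - lo) / M ≤ 1 := div_le_one_of_le₀ (by linarith) hM
  simpa using mul_le_mul_of_nonneg_left this (Nat.cast_nonneg (α := ℝ) k)

lemma sub_le_of_cellIndex_eq {k : ℕ} (hk : 0 < k) {lo M t u : ℝ} (ht : t ∈ Icc lo (lo + M))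
    (hu : u ∈ Icc lo (lo + M)) (h : cellIndex k lo M t = cellIndex k lo M u) :
    u - t ≤ M / k := by
  have hk' : (0 : ℝ) < k := by exact_mod_cast hk
  -- For `M = 0` division by zero puts every point in cell 0, harmlessly, since the range is a
  -- single value.
  rcases eq_or_lt_of_le (show 0 ≤ M by linarith [ht.1, ht.2]) with rfl | hM
  · have := ht.1; have := hu.2
    simp at *
    linarith
  · have h1 : (k : ℝ) * ((u - lo) / M) < cellIndex k lo M u + 1 := Nat.lt_floor_add_one _
    have h2 : (cellIndex k lo M t : ℝ) ≤ (k : ℝ) * ((t - lo) / M) :=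
      Nat.floor_le (mul_nonneg hk'.le (div_nonneg (by linarith [ht.1]) hM.le))
    rw [h] at h2
    rw [le_div_iff₀ hk']
    have h3 : (k : ℝ) * ((u - lo) / M) - k * ((t - lo) / M) ≤ 1 := by linarith
    have h4 : (k : ℝ) * ((u - lo) / M) - k * ((t - lo) / M) = (u - t) * k / M := by
      field_simp; ring
    rw [h4, div_le_one hM] at h3
    exact h3

/-- A net with at most `2 k + 1` points for two monotone functions simultaneously: each point is
reached from a point of the net on its left with small increments of both functions. -/
lemma exists_net (Z : Finset ℝ) {G H : ℝ → ℝ} (hG : MonotoneOn G Z) (hH : MonotoneOn H Z)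
    {lG MG lH MH : ℝ} (hGb : ∀ z ∈ Z, G z ∈ Icc lG (lG + MG))
    (hHb : ∀ z ∈ Z, H z ∈ Icc lH (lH + MH)) {k : ℕ} (hk : 0 < k) :
    ∃ ρ : ℝ → ℝ, (∀ z ∈ Z, ρ z ∈ Z ∧ ρ z ≤ z ∧ G z - G (ρ z) ≤ MG / k ∧ H z - H (ρ z) ≤ MH / k) ∧
      (Z.image ρ).card ≤ 2 * k + 1 := by
  classical
  -- Both indices are nondecreasing in `z`, so two points with the same sum of indices have the same
  -- indices. Labelling by the sum thus costs only the `2 * k + 1` values `0, …, 2 * k` instead of a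
  -- product; each label is represented by its leftmost point.
  set l : ℝ → ℕ := fun z => cellIndex k lG MG (G z) + cellIndex k lH MH (H z) with hl
  have hMG : ∀ z ∈ Z, 0 ≤ MG := fun z hz => by linarith [(hGb z hz).1, (hGb z hz).2]
  have hMH : ∀ z ∈ Z, 0 ≤ MH := fun z hz => by linarith [(hHb z hz).1, (hHb z hz).2]
  have hex : ∀ j : ℕ, ∃ r : ℝ, ∀ z ∈ Z, l z = j → r ∈ Z ∧ l r = j ∧ r ≤ z := by
    intro j
    rcases (Z.filter fun z => l z = j).eq_empty_or_nonempty with h | h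
    · exact ⟨0, fun z hz hj => absurd hj (Finset.filter_eq_empty_iff.1 h hz)⟩
    · have := Finset.mem_filter.1 (Finset.min'_mem _ h)
      exact ⟨_, fun z hz hj => ⟨this.1, this.2, Finset.min'_le _ _ (Finset.mem_filter.2 ⟨hz, hj⟩)⟩⟩
  choose r hr using hex
  refine ⟨fun z => r (l z), fun z hz => ?_, ?_⟩
  · obtain ⟨h1, h2, h3⟩ := hr (l z) z hz rfl
    have m1 := cellIndex_mono k lG (hMG z hz) (hG h1 hz h3)
    have m2 := cellIndex_mono k lH (hMH z hz) (hH h1 hz h3)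
    simp only [hl] at h2 ⊢ h1 m1 m2 h3
    exact ⟨h1, h3, sub_le_of_cellIndex_eq hk (hGb _ h1) (hGb _ hz) (by omega),
      sub_le_of_cellIndex_eq hk (hHb _ h1) (hHb _ hz) (by omega)⟩
  · calc (Z.image fun z => r (l z)).card = ((Z.image l).image r).card := by
          rw [Finset.image_image]; rfl
      _ ≤ (Z.image l).card := Finset.card_image_le
      _ ≤ (Finset.range (2 * k + 1)).card := by
          refine Finset.card_le_card fun j hj => ?_
          obtain ⟨z, hz, rfl⟩ := Finset.mem_image.1 hj
          have h1 := cellIndex_le k (hMG z hz) (hGb z hz).2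
          have h2 := cellIndex_le k (hMH z hz) (hHb z hz).2
          simp only [Finset.mem_range, hl]
          omega
      _ = 2 * k + 1 := Finset.card_range _

/-! ### Approximation by tangents when the slopes have bounded variation. -/

/-- The maximum of minorants lies between each of them and `f`, so at each design point a single
accurate one suffices. -/
lemma affineApprox_of_minorants {n : ℕ} {x : Fin n → ℝ} {f : ℝ → ℝ} {m : ℕ} {ε : ℝ}
    {S : Finset (ℝ × ℝ)} (hS : S.Nonempty) (hm : S.card ≤ m)
    (hsgn : (∀ q ∈ S, 0 ≤ q.1) ∨ ∀ q ∈ S, q.1 ≤ 0)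
    (hmin : ∀ q ∈ S, ∀ i, q.1 * x i + q.2 ≤ f (x i)) {e : Fin n → ℝ}
    (he : ∀ i, ∃ q ∈ S, f (x i) - (q.1 * x i + q.2) ≤ e i) (hε : (∑ i, e i) / n ≤ ε) :
    AffineApprox x f m ε := by
  refine ⟨S, hS, hm, hsgn, le_trans ?_ hε⟩
  unfold loss
  gcongr with i
  obtain ⟨q, hq, h⟩ := he i
  obtain ⟨p, hp, hpe⟩ := exists_affineMax_eq S hS (x i)
  rw [abs_of_nonneg (by rw [hpe]; linarith [hmin p hp i])]
  linarith [le_affineMax hS (x i) hq]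

/-- The tangent of slope `F u` at `u`, as a pair (slope, intercept). -/
def tangent (f F : ℝ → ℝ) (u : ℝ) : ℝ × ℝ := (F u, f u - F u * u)

lemma tangent_apply (f F : ℝ → ℝ) (u t : ℝ) :
    (tangent f F u).1 * t + (tangent f F u).2 = f u + F u * (t - u) := by
  simp only [tangent]; ring

/-- The net is taken for the position and the slope `F` together: the error at `v` of the tangent at
`u = ρ v` is at most `(F v - F u) * (v - u)`, a product of two increments of order `1 / k`. -/
lemma affineApprox_of_subgradient {n : ℕ} (hn : 0 < n) {x : Fin n → ℝ} {a b : ℝ}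
    (hx : ∀ i, x i ∈ Icc a b) {f F : ℝ → ℝ} (hF : ∀ u ∈ Icc a b, IsSubgradient f a b u (F u))
    (hsgn : (∀ u ∈ Icc a b, 0 ≤ F u) ∨ ∀ u ∈ Icc a b, F u ≤ 0) {k : ℕ} (hk : 0 < k) :
    AffineApprox x f (4 * k) ((F b - F a) * (b - a) / (k : ℝ) ^ 2) := by
  classical
  have hn' : (0 : ℝ) < n := by exact_mod_cast hn
  have hk' : (0 : ℝ) < k := by exact_mod_cast hk
  have hFm : MonotoneOn F (Icc a b) := fun u hu v hv huv => by
    rcases huv.eq_or_lt with rfl | h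
    · exact le_rfl
    · exact (hF u hu).le hu hv (hF v hv) h
  set Z : Finset ℝ := Finset.univ.image x with hZ
  have hZm : ∀ z ∈ Z, z ∈ Icc a b := fun z hz => by
    obtain ⟨i, -, rfl⟩ := Finset.mem_image.1 hz; exact hx i
  have hab : a ≤ b := (hx ⟨0, hn⟩).1.trans (hx ⟨0, hn⟩).2
  obtain ⟨ρ, hρ, hcard⟩ := exists_net Z (G := id) (H := F) (monotone_id.monotoneOn _)
    (hFm.mono hZm) (lG := a) (MG := b - a) (lH := F a) (MH := F b - F a)
    (fun z hz => by simpa using hZm z hz)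
    (fun z hz => by
      have hz := hZm z hz
      simpa using And.intro (hFm ⟨le_rfl, hab⟩ hz hz.1) (hFm hz ⟨hab, le_rfl⟩ hz.2)) hk
  have hxZ : ∀ i, x i ∈ Z := fun i => Finset.mem_image_of_mem _ (Finset.mem_univ i)
  have hmem : ∀ q ∈ (Z.image ρ).image (tangent f F), ∃ u ∈ Icc a b, q = tangent f F u := by
    intro q hq
    obtain ⟨u, hu, rfl⟩ := Finset.mem_image.1 hq
    obtain ⟨z, hz, rfl⟩ := Finset.mem_image.1 hu
    exact ⟨_, hZm _ (hρ z hz).1, rfl⟩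
  refine affineApprox_of_minorants (S := (Z.image ρ).image (tangent f F))
    (e := fun _ => (F b - F a) * (b - a) / (k : ℝ) ^ 2)
    (((show Z.Nonempty from ⟨_, hxZ ⟨0, hn⟩⟩).image _).image _)
    (Finset.card_image_le.trans (hcard.trans (by omega))) ?_ ?_ ?_ ?_
  · refine hsgn.imp (fun h q hq => ?_) (fun h q hq => ?_) <;>
    · obtain ⟨u, hu, rfl⟩ := hmem q hq
      exact h u hu
  · intro q hq i
    obtain ⟨u, hu, rfl⟩ := hmem q hq
    rw [tangent_apply]
    exact hF u hu _ (hx i)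
  · intro i
    obtain ⟨h1, h2, h3, h4⟩ := hρ _ (hxZ i)
    refine ⟨_, Finset.mem_image_of_mem _ (Finset.mem_image_of_mem _ (hxZ i)), ?_⟩
    rw [tangent_apply]
    have h5 := hF _ (hx i) _ (hZm _ h1)
    simp only [id] at h3
    have h6 : (F (x i) - F (ρ (x i))) * (x i - ρ (x i)) ≤ (F b - F a) / k * ((b - a) / k) :=
      mul_le_mul h4 h3 (by linarith)
        (div_nonneg (sub_nonneg.2 (hFm ⟨le_rfl, hab⟩ ⟨hab, le_rfl⟩ hab)) hk'.le)
    have h7 : (F b - F a) / k * ((b - a) / k) = (F b - F a) * (b - a) / (k : ℝ) ^ 2 := by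
      field_simp
    linarith
  · simp [mul_div_cancel_left₀ _ hn'.ne']

/-! ### Endpoint derivatives as subgradients. -/

/-- In `EReal` the difference of equal infinities is `⊥`, of absolute value `⊤`, so no infinite
value escapes. -/
lemma exists_real_of_abs_sub_ne_top {r l : EReal} (h : (r - l).abs ≠ ⊤) :
    ∃ c d : ℝ, r = c ∧ l = d := by
  induction r <;> induction l <;> simp_all [sub_eq_add_neg]

lemma derivVariation_toReal {f : ℝ → ℝ} {a b c d : ℝ} (hc : rightDeriv f a = c)
    (hd : leftDeriv f b = d) : (derivVariation f a b).toReal = |c - d| := by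
  rw [derivVariation, hc, hd, ← EReal.coe_sub, EReal.abs_def, ENNReal.toReal_ofReal (abs_nonneg _)]

lemma rightDeriv_le_slope {f : ℝ → ℝ} {a b y : ℝ} (hf : ConvexOn ℝ (Icc a b) f)
    (hy : y ∈ Icc a b) (hay : a < y) :
    rightDeriv f a ≤ (((f y - f a) / (y - a) : ℝ) : EReal) := by
  refine limsup_le_of_le (h := ?_)
  filter_upwards [Ioo_mem_nhdsGT hay] with t ht
  have ha : a ∈ Icc a b := ⟨le_rfl, hy.1.trans hy.2⟩
  exact EReal.coe_le_coe_iff.2 (hf.secant_mono ha ⟨ht.1.le, ht.2.le.trans hy.2⟩ hy ht.1.ne' hay.ne'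
    ht.2.le)

lemma slope_le_leftDeriv {f : ℝ → ℝ} {a b y : ℝ} (hf : ConvexOn ℝ (Icc a b) f)
    (hy : y ∈ Icc a b) (hyb : y < b) :
    (((f y - f b) / (y - b) : ℝ) : EReal) ≤ leftDeriv f b := by
  refine le_limsup_of_frequently_le (Eventually.frequently ?_)
  filter_upwards [Ioo_mem_nhdsLT hyb] with t ht
  have hb : b ∈ Icc a b := ⟨hy.1.trans hy.2, le_rfl⟩
  exact EReal.coe_le_coe_iff.2 (hf.secant_mono hb hy ⟨hy.1.trans ht.1.le, ht.2.le⟩ hyb.ne ht.2.ne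
    ht.1.le)

/-- The concave case is not read off from the convex one for `-f`, because negation turns the upper
limit into a lower one; only the monotonicity of the secants is transferred. -/
lemma slope_le_rightDeriv {f : ℝ → ℝ} {a b y : ℝ} (hf : ConcaveOn ℝ (Icc a b) f)
    (hy : y ∈ Icc a b) (hay : a < y) :
    (((f y - f a) / (y - a) : ℝ) : EReal) ≤ rightDeriv f a := by
  refine le_limsup_of_frequently_le (Eventually.frequently ?_)
  filter_upwards [Ioo_mem_nhdsGT hay] with t ht
  have ha : a ∈ Icc a b := ⟨le_rfl, hy.1.trans hy.2⟩
  have := hf.neg.secant_mono ha ⟨ht.1.le, ht.2.le.trans hy.2⟩ hy ht.1.ne' hay.ne' ht.2.le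
  refine EReal.coe_le_coe_iff.2 (neg_le_neg_iff.1 ?_)
  have e : ∀ r s, -(f r - f s) = (-f) r - (-f) s := fun r s => by simp only [Pi.neg_apply]; ring
  rwa [← neg_div, ← neg_div, e, e]

lemma leftDeriv_le_slope {f : ℝ → ℝ} {a b y : ℝ} (hf : ConcaveOn ℝ (Icc a b) f)
    (hy : y ∈ Icc a b) (hyb : y < b) :
    leftDeriv f b ≤ (((f y - f b) / (y - b) : ℝ) : EReal) := by
  refine limsup_le_of_le (h := ?_)
  filter_upwards [Ioo_mem_nhdsLT hyb] with t ht
  have hb : b ∈ Icc a b := ⟨hy.1.trans hy.2, le_rfl⟩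
  have := hf.neg.secant_mono hb hy ⟨hy.1.trans ht.1.le, ht.2.le⟩ hyb.ne ht.2.ne ht.1.le
  refine EReal.coe_le_coe_iff.2 (neg_le_neg_iff.1 ?_)
  have e : ∀ r s, -(f r - f s) = (-f) r - (-f) s := fun r s => by simp only [Pi.neg_apply]; ring
  rwa [← neg_div, ← neg_div, e, e]

lemma isSubgradient_left {f : ℝ → ℝ} {a b c : ℝ}
    (h : ∀ y ∈ Icc a b, a < y → c ≤ (f y - f a) / (y - a)) : IsSubgradient f a b a c := by
  intro y hy
  rcases hy.1.eq_or_lt with rfl | hay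
  · simp
  · have := h y hy hay
    rw [le_div_iff₀ (by linarith)] at this
    linarith

lemma isSubgradient_right {f : ℝ → ℝ} {a b d : ℝ}
    (h : ∀ y ∈ Icc a b, y < b → (f y - f b) / (y - b) ≤ d) : IsSubgradient f a b b d := by
  intro y hy
  rcases hy.2.eq_or_lt with rfl | hyb
  · simp
  · have := h y hy hyb
    rw [div_le_iff_of_neg (by linarith)] at this
    linarith

lemma exists_isSubgradient_endpoints {f : ℝ → ℝ} {a b : ℝ} (hf : ConvexOn ℝ (Icc a b) f)
    (h : derivVariation f a b ≠ ⊤) :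
    ∃ c d, IsSubgradient f a b a c ∧ IsSubgradient f a b b d ∧
      d - c ≤ (derivVariation f a b).toReal := by
  obtain ⟨c, d, hc, hd⟩ := exists_real_of_abs_sub_ne_top h
  refine ⟨c, d, isSubgradient_left fun y hy hay => ?_, isSubgradient_right fun y hy hyb => ?_, ?_⟩
  · have := rightDeriv_le_slope hf hy hay
    rwa [hc, EReal.coe_le_coe_iff] at this
  · have := slope_le_leftDeriv hf hy hyb
    rwa [hd, EReal.coe_le_coe_iff] at this
  · rw [derivVariation_toReal hc hd, abs_sub_comm]
    exact le_abs_self _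

lemma exists_isSubgradient_endpoints_neg {f : ℝ → ℝ} {a b : ℝ} (hf : ConcaveOn ℝ (Icc a b) f)
    (h : derivVariation f a b ≠ ⊤) :
    ∃ c d, IsSubgradient (-f) a b a c ∧ IsSubgradient (-f) a b b d ∧
      d - c ≤ (derivVariation f a b).toReal := by
  obtain ⟨c, d, hc, hd⟩ := exists_real_of_abs_sub_ne_top h
  refine ⟨-c, -d, isSubgradient_left fun y hy hay => ?_,
    isSubgradient_right fun y hy hyb => ?_, ?_⟩
  · have := slope_le_rightDeriv hf hy hay
    rw [hc, EReal.coe_le_coe_iff] at this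
    refine (neg_le_neg this).trans_eq ?_
    simp only [Pi.neg_apply]; ring
  · have := leftDeriv_le_slope hf hy hyb
    rw [hd, EReal.coe_le_coe_iff] at this
    refine le_trans (le_of_eq ?_) (neg_le_neg this)
    simp only [Pi.neg_apply]; ring
  · rw [derivVariation_toReal hc hd]
    exact le_of_eq_of_le (by ring) (le_abs_self _)

/-- Approximation of a convex monotone function in terms of the variation of its derivative. -/
lemma affineApprox_of_derivVariation {n : ℕ} (hn : 0 < n) {x : Fin n → ℝ} {a b : ℝ} (hab : a < b)
    (hx : ∀ i, x i ∈ Icc a b) {f : ℝ → ℝ} (hf : ConvexOn ℝ (Icc a b) f)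
    (hm : MonotoneOn f (Icc a b) ∨ AntitoneOn f (Icc a b)) {c d W : ℝ}
    (hc : IsSubgradient f a b a c) (hd : IsSubgradient f a b b d) (hW : d - c ≤ W) {k : ℕ}
    (hk : 0 < k) : AffineApprox x f (4 * k) (W * (b - a) / (k : ℝ) ^ 2) := by
  have haI : a ∈ Icc a b := ⟨le_rfl, hab.le⟩
  have hbI : b ∈ Icc a b := ⟨hab.le, le_rfl⟩
  suffices ∃ F : ℝ → ℝ, (∀ u ∈ Icc a b, IsSubgradient f a b u (F u)) ∧ F b - F a ≤ W ∧
      ((∀ u ∈ Icc a b, 0 ≤ F u) ∨ ∀ u ∈ Icc a b, F u ≤ 0) by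
    obtain ⟨F, hF, hFW, hs⟩ := this
    obtain ⟨S, hS, h1, h2, h3⟩ := affineApprox_of_subgradient hn hx hF hs hk
    refine ⟨S, hS, h1, h2, h3.trans ?_⟩
    have := hab.le
    gcongr
  choose! G hG using fun u (hu : u ∈ Ioo a b) => exists_isSubgradient hf hu
  have key : ∀ c' d', IsSubgradient f a b a c' → IsSubgradient f a b b d' → ∃ F : ℝ → ℝ, F a = c' ∧
      F b = d' ∧ ∀ u ∈ Icc a b, IsSubgradient f a b u (F u) := by
    intro c' d' hc' hd'
    refine ⟨fun u => if u = a then c' else if u = b then d' else G u, by simp, by simp [hab.ne'],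
      fun u hu => ?_⟩
    by_cases h1 : u = a
    · subst h1; simpa using hc'
    · by_cases h2 : u = b
      · subst h2; simpa [h1] using hd'
      · simpa [h1, h2] using hG u ⟨lt_of_le_of_ne hu.1 (Ne.symm h1), lt_of_le_of_ne hu.2 h2⟩
  rcases hm with hm | hm
  -- A negative slope at `a` is raised to 0, still a subgradient there since `f a` is the minimum.
  -- This fixes the sign and only reduces the variation of the slopes.
  · have hc0 : IsSubgradient f a b a (max c 0) := by
      intro y hy
      rcases max_choice c 0 with h | h <;> rw [h]
      · exact hc y hy
      · simpa using hm haI hy hy.1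
    obtain ⟨F, h1, h2, h4⟩ := key _ d hc0 hd
    refine ⟨F, h4, ?_, Or.inl fun u hu => ?_⟩
    · rw [h1, h2]; linarith [le_max_left c 0]
    · rcases hu.1.eq_or_lt with rfl | h
      · rw [h1]; exact le_max_right _ _
      · exact (h4 u hu).nonneg hm hu h
  · have hd0 : IsSubgradient f a b b (min d 0) := by
      intro y hy
      rcases min_choice d 0 with h | h <;> rw [h]
      · exact hd y hy
      · simpa using hm hy hbI hy.2
    obtain ⟨F, h1, h2, h4⟩ := key c _ hc hd0
    refine ⟨F, h4, ?_, Or.inr fun u hu => ?_⟩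
    · rw [h1, h2]; linarith [min_le_left d 0]
    · rcases hu.2.eq_or_lt with rfl | h
      · rw [h2]; exact min_le_right _ _
      · exact (h4 u hu).nonpos hm hu h

/-! ### Sums over ranks, constants and pointwise errors for a power modulus. -/

/-- Bernoulli's inequality for `1 - 1 / r`. It makes the sum of `r ^ (δ - 1)` telescope, and is the
inductive step of `sum_rpow_neg_le`. -/
lemma sub_one_rpow_add_le {δ r : ℝ} (h0 : 0 ≤ δ) (h1 : δ ≤ 1) (hr : 1 ≤ r) :
    (r - 1) ^ δ + δ * r ^ (δ - 1) ≤ r ^ δ := by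
  have hr0 : 0 < r := by linarith
  have h := rpow_one_add_le_one_add_mul_self (s := -(1 / r)) (p := δ)
    (by rw [neg_le_neg_iff]; exact (div_le_one hr0).2 hr) h0 h1
  have e1 : (r - 1) ^ δ = r ^ δ * (1 + -(1 / r)) ^ δ := by
    rw [← Real.mul_rpow hr0.le (by linarith [(div_le_one hr0).2 hr])]
    congr 1; field_simp; ring
  have e2 : r ^ (δ - 1) = r ^ δ * (1 / r) := by
    rw [Real.rpow_sub hr0, Real.rpow_one]; ring
  rw [e1, e2]
  have := mul_le_mul_of_nonneg_left h (Real.rpow_nonneg hr0.le δ)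
  linarith

/-- If each `τ i` dominates, up to the factor `K` and the exponent `α`, its rank, then the sum of a
negative power of the `τ i` is controlled by a sum over the ranks. -/
lemma sum_rpow_neg_le {ι : Type*} [DecidableEq ι] (τ : ι → ℝ) {K α γ δ : ℝ} (hK : 0 ≤ K)
    (hγ : 0 ≤ γ) (hδ : 0 ≤ δ) (hγδ : γ + δ = 1) (S : Finset ι)
    (hτ : ∀ i ∈ S, 0 < τ i)
    (h : ∀ i ∈ S, ((S.filter fun j => τ j ≤ τ i).card : ℝ) ≤ K * τ i ^ α) :
    δ * ∑ i ∈ S, τ i ^ (-(α * γ)) ≤ K ^ γ * (S.card : ℝ) ^ δ := by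
  induction S using Finset.induction_on_max_value τ with
  | empty => simpa using mul_nonneg (Real.rpow_nonneg hK γ) (Real.rpow_nonneg le_rfl δ)
  | insert i S hi hmax ih =>
    have ih' := ih (fun j hj => hτ j (Finset.mem_insert_of_mem hj)) fun j hj => by
      refine le_trans ?_ (h j (Finset.mem_insert_of_mem hj))
      gcongr
      exact Finset.subset_insert _ _
    have hτi := hτ i (Finset.mem_insert_self _ _)
    have hcard : ((insert i S).card : ℝ) = S.card + 1 := by
      rw [Finset.card_insert_of_notMem hi]; push_cast; rfl
    -- The inserted `τ i` is the largest, so its rank is the whole cardinality.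
    have h1 : (S.card : ℝ) + 1 ≤ K * τ i ^ α := by
      rw [← hcard]
      convert h i (Finset.mem_insert_self _ _) using 3
      refine (Finset.filter_true_of_mem fun j hj => ?_).symm
      rcases Finset.mem_insert.1 hj with rfl | hj
      · exact le_rfl
      · exact hmax j hj
    have hr : (0 : ℝ) < S.card + 1 := by positivity
    have h2 : τ i ^ (-(α * γ)) ≤ K ^ γ * ((S.card : ℝ) + 1) ^ (δ - 1) := by
      have h3 := Real.rpow_le_rpow hr.le h1 hγ
      rw [Real.mul_rpow hK (Real.rpow_nonneg hτi.le _), ← Real.rpow_mul hτi.le] at h3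
      rw [show δ - 1 = -γ by linarith, Real.rpow_neg hτi.le, Real.rpow_neg hr.le, ← div_eq_mul_inv,
        inv_eq_one_div, div_le_div_iff₀ (Real.rpow_pos_of_pos hτi _) (Real.rpow_pos_of_pos hr _)]
      linarith
    have h4 := sub_one_rpow_add_le (r := (S.card : ℝ) + 1) hδ (by linarith) (by simp)
    rw [add_sub_cancel_right] at h4
    rw [Finset.sum_insert hi, hcard]
    have h5 := mul_le_mul_of_nonneg_left h2 hδ
    have h6 := mul_le_mul_of_nonneg_left h4 (Real.rpow_nonneg hK γ)
    linarith

/-- `α ^ α = exp (α log α)` is at least `exp (-1)`, because `α log α ≥ α - 1`. -/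
lemma one_third_le_rpow {α δ : ℝ} (h0 : 0 < α) (h1 : α ≤ 1) (hδ : δ ≤ α) : 1 / 3 ≤ α ^ δ := by
  refine le_trans ?_ (Real.rpow_le_rpow_of_exponent_ge h0 h1 hδ)
  rw [Real.rpow_def_of_pos h0]
  have h2 : -1 ≤ Real.log α * α := by
    have := mul_le_mul_of_nonneg_right (Real.one_sub_inv_le_log_of_pos h0) h0.le
    rw [sub_mul, inv_mul_cancel₀ h0.ne'] at this
    linarith
  refine le_trans ?_ (Real.exp_le_exp.2 h2)
  rw [Real.exp_neg, one_div]
  exact inv_anti₀ (Real.exp_pos 1) (by linarith [Real.exp_one_lt_d9])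

/-- The sum over ranks produces `1 / α`, while `modulusConst` offers only `(1 / α) ^ (1 / (1 + α))`.
Their ratio `α ^ (-α / (1 + α))` is at most 3. -/
lemma modulusConst_lower_bound {α A : ℝ} (h0 : 0 < α) (h1 : α ≤ 1) (hA : 0 < A) :
    2 * (2 * A) ^ (1 / (1 + α)) * ((1 + α) / α) ≤ 24 * modulusConst α A := by
  have hγ0 : 0 ≤ 1 / (1 + α) := by positivity
  have hγ1 : 1 / (1 + α) ≤ 1 := (div_le_one (by linarith)).2 (by linarith)
  have hc : (A / α) ^ (1 / (1 + α)) ≤ modulusConst α A := by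
    unfold modulusConst
    refine Real.rpow_le_rpow (by positivity) ?_ hγ0
    gcongr
    exact le_mul_of_one_le_left hA.le (Real.one_le_rpow (by norm_num) (by linarith))
  have h2 : (2 * A) ^ (1 / (1 + α)) ≤ 2 * A ^ (1 / (1 + α)) := by
    rw [Real.mul_rpow (by norm_num) hA.le]
    gcongr
    simpa using Real.rpow_le_rpow_of_exponent_le (x := 2) (by norm_num) hγ1
  have h3 : 1 / α ≤ 3 * (1 / α ^ (1 / (1 + α))) := by
    have h4 := one_third_le_rpow h0 h1 (δ := 1 - 1 / (1 + α)) (by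
      rw [sub_le_iff_le_add, ← sub_le_iff_le_add', le_div_iff₀ (by linarith)]
      nlinarith)
    rw [Real.rpow_sub h0, Real.rpow_one, le_div_iff₀ (Real.rpow_pos_of_pos h0 _)] at h4
    rw [mul_one_div, div_le_div_iff₀ h0 (Real.rpow_pos_of_pos h0 _)]
    linarith
  have hAγ : 0 ≤ A ^ (1 / (1 + α)) := Real.rpow_nonneg hA.le _
  calc 2 * (2 * A) ^ (1 / (1 + α)) * ((1 + α) / α)
      ≤ 2 * (2 * A ^ (1 / (1 + α))) * (2 / α) := by gcongr; linarith
    _ = 8 * A ^ (1 / (1 + α)) * (1 / α) := by ring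
    _ ≤ 8 * A ^ (1 / (1 + α)) * (3 * (1 / α ^ (1 / (1 + α)))) := by gcongr
    _ = 24 * (A / α) ^ (1 / (1 + α)) := by rw [Real.div_rpow hA.le h0.le]; ring
    _ ≤ 24 * modulusConst α A := by gcongr

/-- The minimum of `1` and `z` is at most `z ^ η`. The exponent is later chosen to turn the two
bounds for the error into a summable power of `τ`. -/
lemma le_mul_rpow_of_le_of_le {e p z η : ℝ} (hp : 0 ≤ p) (hz : 0 ≤ z) (h0 : 0 ≤ η) (h1 : η ≤ 1)
    (he : e ≤ p) (hez : e ≤ p * z) : e ≤ p * z ^ η := by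
  rcases le_total z 1 with h | h
  · refine hez.trans (mul_le_mul_of_nonneg_left ?_ hp)
    rcases hz.eq_or_lt with rfl | hz
    · exact Real.rpow_nonneg le_rfl _
    · simpa using Real.rpow_le_rpow_of_exponent_ge hz h h1
  · exact he.trans (le_mul_of_one_le_right hp (Real.one_le_rpow h h0))

/-- The error at `v` of the tangent at `u`, controlled by the increment of the value at `b` of the
tangent. -/
lemma tangent_error_mul_le {f : ℝ → ℝ} {a b u v c d : ℝ} (hu : u ∈ Icc a b) (hub : v ≤ b)
    (hd : IsSubgradient f a b v d) :
    (f v - (f u + c * (v - u))) * (b - u) ≤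
      ((f v + d * (b - v)) - (f u + c * (b - u))) * (v - u) := by
  have h1 := hd u hu
  have h2 : f v - (f u + c * (v - u)) ≤ (d - c) * (v - u) := by linarith
  have h3 := mul_le_mul_of_nonneg_left h2 (sub_nonneg.2 hub)
  linarith

lemma sub_le_of_sqrt_sub_le {s t r : ℝ} (hs : 0 ≤ s) (ht : 0 ≤ t) (hst : s ≤ t)
    (h : √t - √s ≤ r) : t - s ≤ 2 * √t * r := by
  have h1 : t - s = (√t + √s) * (√t - √s) := by
    have := Real.sq_sqrt hs; have := Real.sq_sqrt ht; ring_nf; linarith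
  have h2 : √s ≤ √t := Real.sqrt_le_sqrt hst
  rw [h1]
  exact mul_le_mul (by linarith) h (by linarith) (by positivity)

/-- The sum of the tangent errors over the points whose rank is controlled. -/
lemma sum_error_le {n k : ℕ} (hn : 0 < n) (hk : 0 < k) {τ : Fin n → ℝ} {A α V : ℝ} (hA : 0 < A)
    (h0 : 0 < α) (h1 : α ≤ 1) (hV : 0 ≤ V) (I : Finset (Fin n)) (hτ : ∀ i ∈ I, 0 < τ i)
    (h : ∀ i ∈ I, ((I.filter fun j => τ j ≤ τ i).card : ℝ) ≤ 2 * A * n * τ i ^ α) :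
    ∑ i ∈ I, V / k * (2 / (k * √(τ i))) ^ (2 * α / (1 + α)) ≤
      n * (24 * (modulusConst α A * V / (k : ℝ) ^ rateExponent α)) := by
  have hn' : (0 : ℝ) < n := by exact_mod_cast hn
  have hk' : (0 : ℝ) < k := by exact_mod_cast hk
  have hα : 0 < 1 + α := by linarith
  set γ := 1 / (1 + α) with hγ
  set δ := α / (1 + α) with hδ
  have hδ0 : 0 < δ := by positivity
  have hγ0 : 0 < γ := by positivity
  have hγδ : γ + δ = 1 := by rw [hγ, hδ]; field_simp
  have hη : 2 * α / (1 + α) = 2 * δ := by rw [hδ]; ring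
  -- The exponents satisfy `α * γ = δ = 1 - γ`, so that `(2 A n) ^ γ * n ^ δ = (2 A) ^ γ * n` is
  -- linear in `n`.
  have hs := sum_rpow_neg_le τ (K := 2 * A * n) (α := α) (γ := γ) (δ := δ) (by positivity) hγ0.le
    hδ0.le hγδ I hτ h
  have hcard : (I.card : ℝ) ^ δ ≤ (n : ℝ) ^ δ := by
    refine Real.rpow_le_rpow (by positivity) ?_ hδ0.le
    exact_mod_cast (Finset.card_le_univ I).trans_eq (Fintype.card_fin n)
  have hs' : ∑ i ∈ I, τ i ^ (-δ) ≤ n * ((2 * A) ^ γ * ((1 + α) / α)) := by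
    have e : α * γ = δ := by rw [hγ, hδ]; ring
    rw [e] at hs
    have h2 : (2 * A * n) ^ γ * (I.card : ℝ) ^ δ ≤ (2 * A) ^ γ * n := by
      refine (mul_le_mul_of_nonneg_left hcard (by positivity)).trans_eq ?_
      rw [Real.mul_rpow (by positivity) hn'.le, mul_assoc, ← Real.rpow_add hn', hγδ, Real.rpow_one]
    have h3 := (le_div_iff₀' hδ0).2 (hs.trans h2)
    refine h3.trans_eq ?_
    rw [hδ]; field_simp
  have hterm : ∀ i ∈ I, V / k * (2 / (k * √(τ i))) ^ (2 * α / (1 + α)) ≤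
      V / (k : ℝ) ^ rateExponent α * 2 * τ i ^ (-δ) := by
    intro i hi
    have hτi := hτ i hi
    have e1 : (2 / (k * √(τ i))) ^ (2 * δ) = 2 ^ (2 * δ) / (k : ℝ) ^ (2 * δ) * τ i ^ (-δ) := by
      rw [Real.div_rpow (by norm_num) (by positivity), Real.mul_rpow hk'.le (Real.sqrt_nonneg _),
        Real.sqrt_eq_rpow, ← Real.rpow_mul hτi.le, show 1 / 2 * (2 * δ) = δ by ring,
        Real.rpow_neg hτi.le]
      field_simp
    have e2 : (2 : ℝ) ^ (2 * δ) ≤ 2 := by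
      have : 2 * δ ≤ 1 := by
        rw [hδ, mul_div_assoc', div_le_one hα]; linarith
      simpa using Real.rpow_le_rpow_of_exponent_le (x := 2) (by norm_num) this
    have e3 : (k : ℝ) ^ rateExponent α = k * (k : ℝ) ^ (2 * δ) := by
      have : rateExponent α = 1 + 2 * δ := by
        rw [rateExponent, hδ]; field_simp; ring
      rw [this, Real.rpow_add hk', Real.rpow_one]
    rw [hη, e1, e3]
    have : V / k * (2 ^ (2 * δ) / (k : ℝ) ^ (2 * δ) * τ i ^ (-δ)) =
        V / (k * (k : ℝ) ^ (2 * δ)) * 2 ^ (2 * δ) * τ i ^ (-δ) := by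
      field_simp
    rw [this]
    gcongr
  have hVk : 0 ≤ V / (k : ℝ) ^ rateExponent α := by positivity
  calc _ ≤ ∑ i ∈ I, V / (k : ℝ) ^ rateExponent α * 2 * τ i ^ (-δ) := Finset.sum_le_sum hterm
    _ = V / (k : ℝ) ^ rateExponent α * 2 * ∑ i ∈ I, τ i ^ (-δ) := by rw [Finset.mul_sum]
    _ ≤ V / (k : ℝ) ^ rateExponent α * 2 * (n * ((2 * A) ^ γ * ((1 + α) / α))) := by gcongr
    _ = n * (V / (k : ℝ) ^ rateExponent α * (2 * (2 * A) ^ γ * ((1 + α) / α))) := by ring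
    _ ≤ n * (V / (k : ℝ) ^ rateExponent α * (24 * modulusConst α A)) := by
        have := modulusConst_lower_bound h0 h1 hA
        gcongr
    _ = _ := by ring

/-! ### Approximation by tangents under a power modulus. -/

/-- Approximation of a convex nondecreasing function when the design has a power modulus at the right
endpoint. -/
lemma affineApprox_of_monotoneOn {n : ℕ} (hn : 0 < n) {x : Fin n → ℝ} {a b : ℝ} (hab : a < b)
    (hx : ∀ i, x i ∈ Icc a b) {f : ℝ → ℝ} (hf : ConvexOn ℝ (Icc a b) f)
    (hm : MonotoneOn f (Icc a b)) {ω A α : ℝ} (hω : 0 ≤ ω) (hA : 0 < A) (h0 : 0 < α) (h1 : α ≤ 1)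
    (hQ : ∀ t ∈ Icc a b, ((Finset.univ.filter fun i => t ≤ x i).card : ℝ) ≤
      n * (ω + A * ((b - t) / (b - a)) ^ α)) {k : ℕ} (hk : 0 < k) :
    AffineApprox x f (4 * k) (24 * (modulusConst α A * (f b - f a) / (k : ℝ) ^ rateExponent α) +
      2 * (f b - f a) * ω) := by
  classical
  have hn' : (0 : ℝ) < n := by exact_mod_cast hn
  have hk' : (0 : ℝ) < k := by exact_mod_cast hk
  have hba : 0 < b - a := sub_pos.2 hab
  have haI : a ∈ Icc a b := ⟨le_rfl, hab.le⟩
  have hbI : b ∈ Icc a b := ⟨hab.le, le_rfl⟩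
  set V := f b - f a with hVdef
  have hV : 0 ≤ V := sub_nonneg.2 (hm haI hbI hab.le)
  set τ : ℝ → ℝ := fun t => (b - t) / (b - a) with hτdef
  have hτ0 : ∀ t ∈ Icc a b, 0 ≤ τ t := fun t ht => div_nonneg (sub_nonneg.2 ht.2) hba.le
  have hτ1 : ∀ t ∈ Icc a b, τ t ≤ 1 := fun t ht => (div_le_one hba).2 (by linarith [ht.1])
  have hτm : ∀ {s t}, τ s ≤ τ t ↔ t ≤ s := fun {s t} => by
    rw [hτdef]; simp only [div_le_div_iff_of_pos_right hba]; constructor <;> intro h <;> linarith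
  -- The point `b` is left out, since the slope may be infinite there.
  have hsub : ∀ u ∈ Ico a b, ∃ c, IsSubgradient f a b u c ∧ 0 ≤ c := by
    intro u hu
    rcases hu.1.eq_or_lt with rfl | h
    · exact ⟨0, fun y hy => by simpa using hm haI hy hy.1, le_rfl⟩
    · obtain ⟨c, hc⟩ := exists_isSubgradient hf ⟨h, hu.2⟩
      exact ⟨c, hc, hc.nonneg hm (Ico_subset_Icc_self hu) h⟩
  choose! F hF hF0 using hsub
  -- The points where the power term of the modulus dominates the atom `ω`. For them the rank is at
  -- most `2 A n τ ^ α`, which excludes the position `b`; the others number at most `2 n ω`.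
  set I : Finset (Fin n) := Finset.univ.filter fun i => ω ≤ A * τ (x i) ^ α with hI
  have hrank : ∀ i ∈ I, ((Finset.univ.filter fun j => x i ≤ x j).card : ℝ) ≤
      2 * A * n * τ (x i) ^ α := by
    intro i hi
    refine (hQ _ (hx i)).trans ?_
    have := (Finset.mem_filter.1 hi).2
    have := mul_le_mul_of_nonneg_left this hn'.le
    simp only [hτdef] at *
    linarith
  have hτpos : ∀ i ∈ I, 0 < τ (x i) := by
    intro i hi
    refine lt_of_le_of_ne (hτ0 _ (hx i)) fun he => ?_
    have h2 := hrank i hi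
    rw [← he, Real.zero_rpow h0.ne', mul_zero] at h2
    have : 0 < (Finset.univ.filter fun j => x i ≤ x j).card :=
      Finset.card_pos.2 ⟨i, by simp⟩
    have : (0 : ℝ) < (Finset.univ.filter fun j => x i ≤ x j).card := by exact_mod_cast this
    linarith
  set Z : Finset ℝ := I.image x with hZ
  have hxZ : ∀ i ∈ I, x i ∈ Z := fun i hi => Finset.mem_image_of_mem _ hi
  have hZm : ∀ z ∈ Z, z ∈ Ico a b := by
    intro z hz
    obtain ⟨i, hi, rfl⟩ := Finset.mem_image.1 hz
    refine ⟨(hx i).1, lt_of_le_of_ne (hx i).2 fun he => ?_⟩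
    have := hτpos i hi
    simp [hτdef, he] at this
  have hinc : ∀ u ∈ Ico a b, ∀ v ∈ Ico a b, u ≤ v →
      f u + F u * (b - u) ≤ f v + F v * (b - v) := by
    intro u hu v hv huv
    rcases huv.eq_or_lt with rfl | hlt
    · exact le_rfl
    have h2 := (hF u hu).le (Ico_subset_Icc_self hu) (Ico_subset_Icc_self hv) (hF v hv) hlt
    have h3 := hF u hu v (Ico_subset_Icc_self hv)
    have h4 := mul_le_mul_of_nonneg_right h2 (sub_nonneg.2 hv.2.le)
    linarith
  -- The square root refines the net near `b`: a step `1 / k` in `√τ` gives `τ u - τ v ≤ 2 √(τ u) /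
  -- k`. The second function is the value at `b` of the tangent.
  obtain ⟨ρ, hρ, hcard⟩ := exists_net Z (G := fun t => -√(τ t)) (H := fun t => f t + F t * (b - t))
    (fun u _ v _ huv => neg_le_neg (Real.sqrt_le_sqrt (hτm.2 huv)))
    (fun u hu v hv huv => hinc u (hZm u hu) v (hZm v hv) huv)
    (lG := -1) (MG := 1) (lH := f a) (MH := V)
    (fun z hz => by
      have := Real.sqrt_le_one.2 (hτ1 z (Ico_subset_Icc_self (hZm z hz)))
      constructor <;> linarith [Real.sqrt_nonneg (τ z)])
    (fun z hz => by
      have hz := hZm z hz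
      have h2 := hF z hz b hbI
      have h3 := hm haI (Ico_subset_Icc_self hz) hz.1
      have h4 := mul_nonneg (hF0 z hz) (sub_nonneg.2 hz.2.le)
      constructor <;> linarith) hk
  have hmem : ∀ q ∈ (Z.image ρ).image (tangent f F), ∃ u ∈ Ico a b, q = tangent f F u := by
    intro q hq
    obtain ⟨u, hu, rfl⟩ := Finset.mem_image.1 hq
    obtain ⟨z, hz, rfl⟩ := Finset.mem_image.1 hu
    exact ⟨_, hZm _ (hρ z hz).1, rfl⟩
  -- The constant `f a` serves the points outside `I`, with error at most `V`. With it there are at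
  -- most `2 * k + 2 ≤ 4 * k` functions.
  refine affineApprox_of_minorants (S := insert (0, f a) ((Z.image ρ).image (tangent f F)))
    (e := fun i => if i ∈ I then V / k * (2 / (k * √(τ (x i)))) ^ (2 * α / (1 + α)) else V)
    (Finset.insert_nonempty _ _) ?_ (Or.inl ?_) ?_ ?_ ?_
  · refine (Finset.card_insert_le _ _).trans ?_
    have := (Finset.card_image_le (s := Z.image ρ) (f := tangent f F)).trans hcard
    omega
  · intro q hq
    rcases Finset.mem_insert.1 hq with rfl | hq
    · exact le_rfl
    · obtain ⟨u, hu, rfl⟩ := hmem q hq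
      exact hF0 u hu
  · intro q hq i
    rcases Finset.mem_insert.1 hq with rfl | hq
    · simpa using hm haI (hx i) (hx i).1
    · obtain ⟨u, hu, rfl⟩ := hmem q hq
      rw [tangent_apply]
      exact hF u hu _ (hx i)
  · intro i
    by_cases hi : i ∈ I
    swap
    · refine ⟨_, Finset.mem_insert_self _ _, ?_⟩
      rw [if_neg hi]
      have := hm (hx i) hbI (hx i).2
      simp only [zero_mul, zero_add]
      linarith
    · obtain ⟨g1, g2, g3, g4⟩ := hρ _ (hxZ i hi)
      refine ⟨_, Finset.mem_insert_of_mem (Finset.mem_image_of_mem _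
        (Finset.mem_image_of_mem _ (hxZ i hi))), ?_⟩
      rw [if_pos hi, tangent_apply]
      set v := x i with hv
      set u := ρ v with hu
      have huI := hZm u g1
      have hvI := hZm v (hxZ i hi)
      have hu' := Ico_subset_Icc_self huI
      set E := f v - (f u + F u * (v - u)) with hE
      set Δ := (f v + F v * (b - v)) - (f u + F u * (b - u)) with hΔ
      have hΔ0 : 0 ≤ Δ := sub_nonneg.2 (hinc u huI v hvI g2)
      have key : E * (b - u) ≤ Δ * (v - u) := tangent_error_mul_le hu' hvI.2.le (hF v hvI)
      have hτv : 0 < τ v := hτpos i hi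
      have hτuv : τ v ≤ τ u := hτm.2 g2
      have hτu : 0 < τ u := hτv.trans_le hτuv
      have key2 : E * τ u ≤ Δ * (τ u - τ v) := by
        have e1 : E * τ u = E * (b - u) / (b - a) := by simp only [hτdef]; ring
        have e2 : Δ * (τ u - τ v) = Δ * (v - u) / (b - a) := by simp only [hτdef]; ring
        rw [e1, e2]
        gcongr
      have hEΔ : E ≤ V / k := by
        refine le_trans (le_of_mul_le_mul_right (key2.trans ?_) hτu) g4
        exact mul_le_mul_of_nonneg_left (by linarith) hΔ0
      refine le_mul_rpow_of_le_of_le (by positivity) (by positivity) (by positivity) ?_ hEΔ ?_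
      · rw [div_le_one (by linarith)]; linarith
      · have h2 := sub_le_of_sqrt_sub_le hτv.le hτu.le hτuv (r := 1 / k) (by linarith)
        have h3 : E * τ u ≤ V / k * (2 * √(τ u) * (1 / k)) := by
          refine key2.trans (mul_le_mul g4 h2 (sub_nonneg.2 hτuv) (by positivity))
        have hsu : 0 < √(τ u) := Real.sqrt_pos.2 hτu
        have hsv : 0 < √(τ v) := Real.sqrt_pos.2 hτv
        have h4 : E ≤ V / k * (2 / (k * √(τ u))) := by
          refine le_of_mul_le_mul_right (h3.trans_eq ?_) hτu
          nth_rewrite 3 [← Real.mul_self_sqrt hτu.le]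
          field_simp
        refine h4.trans ?_
        have := Real.sqrt_le_sqrt hτuv
        gcongr
  · rw [div_le_iff₀ hn', Finset.sum_ite, Finset.filter_mem_eq_inter, Finset.univ_inter,
      Finset.sum_const, nsmul_eq_mul]
    have hs := sum_error_le hn hk (τ := fun i => τ (x i)) hA h0 h1 hV I hτpos fun i hi => by
      refine le_trans ?_ (hrank i hi)
      gcongr
      intro j hj
      simpa using hτm.1 (Finset.mem_filter.1 hj).2
    have hc : ((Finset.univ.filter fun i => i ∉ I).card : ℝ) ≤ 2 * n * ω := by
      rcases (Finset.univ.filter fun i => i ∉ I).eq_empty_or_nonempty with he | hne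
      · rw [he]; simpa using by positivity
      -- All the points outside `I` lie to the right of the leftmost of them, whose rank is below `2
      -- n ω`.
      · obtain ⟨i, hi, hmin⟩ := Finset.exists_min_image _ x hne
        have h2 : ((Finset.univ.filter fun i => i ∉ I).card : ℝ) ≤
            (Finset.univ.filter fun j => x i ≤ x j).card :=
          Nat.cast_le.2 (Finset.card_le_card fun j hj => by simpa using hmin j hj)
        have h3 : A * τ (x i) ^ α < ω := by
          simpa [hI] using (Finset.mem_filter.1 hi).2
        have h4 := mul_lt_mul_of_pos_left h3 hn'
        have h5 := hQ _ (hx i)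
        simp only [hτdef] at h4
        linarith
    have := mul_le_mul_of_nonneg_right hc hV
    linarith

lemma convexOn_reflect {f : ℝ → ℝ} {a b : ℝ} (hf : ConvexOn ℝ (Icc a b) f) :
    ConvexOn ℝ (Icc a b) fun t => f (a + b - t) := by
  refine ⟨convex_Icc a b, fun u hu v hv p q hp hq hpq => ?_⟩
  have := hf.2 (x := a + b - u) ⟨by linarith [hu.2], by linarith [hu.1]⟩ (y := a + b - v)
    ⟨by linarith [hv.2], by linarith [hv.1]⟩ hp hq hpq
  refine le_of_eq_of_le ?_ this
  simp only [smul_eq_mul]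
  congr 1
  linear_combination -(a + b) * hpq

/-- Approximation of a convex monotone function when the design has a power modulus at both
endpoints. -/
lemma affineApprox_of_modulus {n : ℕ} (hn : 0 < n) {x : Fin n → ℝ} {a b : ℝ} (hab : a < b)
    (hx : ∀ i, x i ∈ Icc a b) {f : ℝ → ℝ} (hf : ConvexOn ℝ (Icc a b) f)
    (hm : MonotoneOn f (Icc a b) ∨ AntitoneOn f (Icc a b)) {ω A α : ℝ} (hω : 0 ≤ ω) (hA : 0 < A)
    (h0 : 0 < α) (h1 : α ≤ 1)
    (hQb : ∀ t ∈ Icc a b, ((Finset.univ.filter fun i => t ≤ x i).card : ℝ) ≤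
      n * (ω + A * ((b - t) / (b - a)) ^ α))
    (hQa : ∀ t ∈ Icc a b, ((Finset.univ.filter fun i => x i ≤ t).card : ℝ) ≤
      n * (ω + A * ((t - a) / (b - a)) ^ α)) {k : ℕ} (hk : 0 < k) :
    AffineApprox x f (4 * k) (24 * (modulusConst α A * |f a - f b| / (k : ℝ) ^ rateExponent α) +
      2 * |f a - f b| * ω) := by
  have haI : a ∈ Icc a b := ⟨le_rfl, hab.le⟩
  have hbI : b ∈ Icc a b := ⟨hab.le, le_rfl⟩
  rcases hm with hm | hm
  · have := hm haI hbI hab.le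
    rw [abs_sub_comm, abs_of_nonneg (by linarith)]
    exact affineApprox_of_monotoneOn hn hab hx hf hm hω hA h0 h1 hQb hk
  · have := hm haI hbI hab.le
    rw [abs_of_nonneg (by linarith)]
    have hr : ∀ t ∈ Icc a b, a + b - t ∈ Icc a b := fun t ht =>
      ⟨by linarith [ht.2], by linarith [ht.1]⟩
    have := affineApprox_of_monotoneOn hn hab (x := fun i => a + b - x i) (fun i => hr _ (hx i))
      (convexOn_reflect hf) (fun u hu v hv huv => hm (hr v hv) (hr u hu) (by linarith)) hω hA h0 h1
      (fun t ht => by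
        have := hQa _ (hr t ht)
        rw [show a + b - t - a = b - t by ring] at this
        rwa [Finset.filter_congr (q := fun i => x i ≤ a + b - t)
          fun i _ => by constructor <;> intro h <;> linarith]) hk
    simp only [add_sub_cancel_right, add_sub_cancel_left] at this
    exact this.of_reflect (a + b)

/-! ### From the modulus to counts, and the choice of the number of pieces. -/

lemma card_le_of_isModulus {n : ℕ} (hn : 0 < n) {x : Fin n → ℝ} {w : ℝ → ℝ}
    (hw : IsModulus (designMeasure x) w) {I : Set ℝ} (hI : I.OrdConnected)
    (hb : Bornology.IsBounded I) [DecidablePred fun i => x i ∈ I] :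
    ((Finset.univ.filter fun i => x i ∈ I).card : ℝ) ≤ n * w (volume I).toReal := by
  have hn' : (n : ℝ≥0∞) ≠ 0 := by exact_mod_cast hn.ne'
  have h := hw.le I hI hb
  have hmeas : MeasurableSet I := hI.measurableSet
  have e : designMeasure x I =
      (n : ℝ≥0∞)⁻¹ * ((Finset.univ.filter fun i => x i ∈ I).card : ℝ≥0∞) := by
    simp only [designMeasure, Measure.smul_apply, smul_eq_mul, Measure.finsetSum_apply]
    congr 1
    simp [Measure.dirac_apply' _ hmeas, indicator_apply]
  rw [e, mul_comm, ← div_eq_mul_inv, ENNReal.div_le_iff hn' (ENNReal.natCast_ne_top n)] at h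
  have h2 := ENNReal.toReal_mono (by finiteness) h
  rw [ENNReal.toReal_mul, ENNReal.toReal_ofReal (hw.nonneg _ ENNReal.toReal_nonneg)] at h2
  simpa [mul_comm] using h2

/-- The risk bound in terms of a bound for the loss to one class of extremal functions. -/
lemma riskBound_le_of_lossToClass {n : ℕ} (hn : 0 < n) {κ : ℝ} (hκ : 0 ≤ κ)
    {σ : ℝ → ℝ≥0∞} {x : Fin n → ℝ} {G : Set (ℝ → ℝ)} {f : ℝ → ℝ} {p : ℝ}
    (hp : p ∈ Icc (1 : ℝ) 2) (hσ : σ p ≠ ⊤) {D : ℕ}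
    (hD : 1 ≤ D) {ε : ℝ} (hε : 0 ≤ ε)
    (h : lossToClass x f (extremalSet x G D) ≤ ENNReal.ofReal ε) :
    riskBound κ σ x G f ≤
      ENNReal.ofReal (3 * ε + κ * ((σ p).toReal * ((D : ℝ) / n) ^ (1 - 1 / p))) := by
  refine (iInf₂_le D hD).trans ?_
  rw [ENNReal.ofReal_add (by positivity) (by positivity), ENNReal.ofReal_mul (by norm_num),
    ENNReal.ofReal_mul hκ, ENNReal.ofReal_mul ENNReal.toReal_nonneg, ENNReal.ofReal_toReal hσ]
  refine add_le_add ?_ ?_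
  · simpa using mul_le_mul_right h 3
  · gcongr
    exact iInf₂_le p hp

/-- The choice of the number of pieces. -/
lemma le_of_forall_pieces {n : ℕ} (hn : 0 < n) {B : ℝ≥0∞} {κ s β σ L R : ℝ} (hκ : 0 ≤ κ)
    (hs0 : 0 ≤ s) (hs1 : s ≤ 1) (hβ0 : 1 ≤ β) (hσ : 0 ≤ σ) (hL : 0 ≤ L) (hR : 0 ≤ R)
    (h : ∀ k : ℕ, 0 < k → B ≤ ENNReal.ofReal
      (72 * (L / (k : ℝ) ^ β + R) + κ * (σ * (((12 * k : ℕ) : ℝ) / n) ^ s))) :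
    B ≤ ENNReal.ofReal ((144 + 24 * κ) *
      (σ ^ (β / (s + β)) * (L / (n : ℝ) ^ β) ^ (s / (s + β)) + R + σ / (n : ℝ) ^ s)) := by
  have hn' : (0 : ℝ) < n := by exact_mod_cast hn
  have hsβ : 0 < s + β := by linarith
  rcases hσ.eq_or_lt with rfl | hσ
  -- Without noise the degree costs nothing, and `k` tends to infinity.
  · have hlim : Tendsto (fun k : ℕ => ENNReal.ofReal (72 * (L / (k : ℝ) ^ β + R))) atTop
        (𝓝 (ENNReal.ofReal (72 * (0 + R)))) := by
      refine (ENNReal.continuous_ofReal.tendsto _).comp (Tendsto.const_mul _ (Tendsto.add_const _ ?_))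
      exact Tendsto.const_div_atTop
        ((tendsto_rpow_atTop (by linarith)).comp tendsto_natCast_atTop_atTop) _
    refine (ge_of_tendsto hlim ?_).trans (ENNReal.ofReal_le_ofReal ?_)
    · filter_upwards [eventually_gt_atTop 0] with k hk
      simpa using h k hk
    · rw [Real.zero_rpow (by positivity)]
      have := mul_nonneg hκ hR
      simp only [zero_mul, zero_add, zero_div, add_zero]
      linarith
  have hns : 0 < (n : ℝ) ^ s := Real.rpow_pos_of_pos hn' s
  set M := σ ^ (β / (s + β)) * (L / (n : ℝ) ^ β) ^ (s / (s + β)) with hM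
  have hM0 : 0 ≤ M := by positivity
  have hpow : ∀ c : ℝ, 1 ≤ c → c ^ s ≤ c := fun c hc => by
    simpa using Real.rpow_le_rpow_of_exponent_le hc hs1
  -- The real number of pieces at which `L / T ^ β = σ * T ^ s / n ^ s`; the common value is `M`.
  set T := (L * (n : ℝ) ^ s / σ) ^ (1 / (s + β)) with hT
  have hT0 : 0 ≤ T := by positivity
  have hTpow : T ^ (s + β) = L * (n : ℝ) ^ s / σ := by
    rw [hT, ← Real.rpow_mul (by positivity), one_div_mul_cancel hsβ.ne', Real.rpow_one]
  -- If `T ≤ 1`, then `L ≤ σ / n ^ s` and one piece suffices; otherwise rounding `T` up at most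
  -- doubles it.
  rcases le_or_gt T 1 with hT1 | hT1
  · refine (h 1 one_pos).trans (ENNReal.ofReal_le_ofReal ?_)
    have h1 : L ≤ σ / (n : ℝ) ^ s := by
      have := Real.rpow_le_one hT0 hT1 hsβ.le
      rw [hTpow, div_le_one hσ] at this
      rwa [le_div_iff₀ hns]
    have h2 : (((12 * 1 : ℕ) : ℝ) / n) ^ s ≤ 12 / (n : ℝ) ^ s := by
      rw [Real.div_rpow (by positivity) hn'.le]
      gcongr
      simpa using hpow 12 (by norm_num)
    have h3 : σ * (((12 * 1 : ℕ) : ℝ) / n) ^ s ≤ 12 * (σ / (n : ℝ) ^ s) := by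
      refine (mul_le_mul_of_nonneg_left h2 hσ.le).trans_eq (by ring)
    have h4 := mul_le_mul_of_nonneg_left h3 hκ
    have h5 : 0 ≤ κ * (σ / (n : ℝ) ^ s) := by positivity
    have h6 : 0 ≤ κ * (M + R) := by positivity
    have h7 : 0 ≤ σ / (n : ℝ) ^ s := by positivity
    simp only [Nat.cast_one, Real.one_rpow, div_one]
    linarith
  · have hTpos : 0 < T := by linarith
    have hLpos : 0 < L := by
      rcases hL.eq_or_lt with rfl | hL
      · rw [hT, zero_mul, zero_div, Real.zero_rpow (by positivity)] at hT1
        linarith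
      · exact hL
    have hML : L / T ^ β = M := by
      have e1 : T ^ β = L ^ (β / (s + β)) * (n : ℝ) ^ (s * β / (s + β)) / σ ^ (β / (s + β)) := by
        rw [hT, ← Real.rpow_mul (by positivity), Real.div_rpow (by positivity) hσ.le,
          Real.mul_rpow hL hns.le, ← Real.rpow_mul hn'.le]
        congr 2 <;> ring_nf
      have e2 : L = L ^ (β / (s + β)) * L ^ (s / (s + β)) := by
        rw [← Real.rpow_add hLpos, ← add_div, add_comm β s, div_self hsβ.ne', Real.rpow_one]
      have e3 : ((n : ℝ) ^ β) ^ (s / (s + β)) = (n : ℝ) ^ (s * β / (s + β)) := by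
        rw [← Real.rpow_mul hn'.le]; congr 1; ring
      rw [hM, Real.div_rpow hL (by positivity), e3, e1, div_eq_iff (by positivity)]
      nth_rewrite 1 [e2]
      field_simp
    have hMσ : σ * T ^ s / (n : ℝ) ^ s = M := by
      rw [← hML, div_eq_div_iff hns.ne' (by positivity), mul_assoc, ← Real.rpow_add hTpos, hTpow]
      field_simp
    have hk0 : 0 < ⌈T⌉₊ := Nat.ceil_pos.2 hTpos
    refine (h ⌈T⌉₊ hk0).trans (ENNReal.ofReal_le_ofReal ?_)
    have hk1 : T ≤ (⌈T⌉₊ : ℝ) := Nat.le_ceil T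
    have hk2 : (⌈T⌉₊ : ℝ) ≤ 2 * T := by linarith [Nat.ceil_lt_add_one hT0]
    have h1 : L / (⌈T⌉₊ : ℝ) ^ β ≤ M := by
      rw [← hML]
      gcongr
    have h2 : (((12 * ⌈T⌉₊ : ℕ) : ℝ) / n) ^ s ≤ 24 * (T ^ s / (n : ℝ) ^ s) := by
      rw [Real.div_rpow (by positivity) hn'.le, mul_div_assoc']
      gcongr
      calc ((12 * ⌈T⌉₊ : ℕ) : ℝ) ^ s ≤ (24 * T) ^ s := by
            refine Real.rpow_le_rpow (by positivity) ?_ hs0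
            push_cast
            linarith
        _ = 24 ^ s * T ^ s := Real.mul_rpow (by norm_num) hT0
        _ ≤ 24 * T ^ s := by gcongr; exact hpow 24 (by norm_num)
    have h3 : σ * (((12 * ⌈T⌉₊ : ℕ) : ℝ) / n) ^ s ≤ 24 * M := by
      refine (mul_le_mul_of_nonneg_left h2 hσ.le).trans_eq ?_
      rw [← hMσ]; ring
    have h4 := mul_le_mul_of_nonneg_left h3 hκ
    have h5 : 0 ≤ κ * (R + σ / (n : ℝ) ^ s) := by positivity
    have h6 : 0 ≤ σ / (n : ℝ) ^ s := by positivity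
    linarith

lemma rateExponent_bounds {α : ℝ} (h0 : 0 < α) (h1 : α ≤ 1) :
    1 < rateExponent α ∧ rateExponent α ≤ 2 := by
  have : 0 < 1 + α := by linarith
  rw [rateExponent, lt_div_iff₀ this, div_le_iff₀ this]
  constructor <;> linarith

/-- The risk bound when `f` or `-f` is approximated at the rate `k ^ (-β)` by maxima of `4 k` affine
functions. -/
lemma riskBound_le_of_approx {n : ℕ} (hn : 0 < n) {κ : ℝ} (hκ : 0 ≤ κ) {σ : ℝ → ℝ≥0∞}
    {x : Fin n → ℝ} {a b : ℝ} (hx : ∀ i, x i ∈ Icc a b) {f : ℝ → ℝ} {p : ℝ}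
    (hp : p ∈ Icc (1 : ℝ) 2) (hσ : σ p ≠ ⊤) {s : ℝ} (hs : s = 1 - 1 / p) {β L R : ℝ} (hβ0 : 1 ≤ β)
    (hL : 0 ≤ L) (hR : 0 ≤ R)
    (h : ∀ k : ℕ, 0 < k → AffineApprox x f (4 * k) (24 * (L / (k : ℝ) ^ β + R)) ∨
      AffineApprox x (-f) (4 * k) (24 * (L / (k : ℝ) ^ β + R))) :
    riskBound κ σ x (monoConvexConcave a b) f ≤ ENNReal.ofReal ((144 + 24 * κ) *
      ((σ p).toReal ^ (β / (s + β)) * (L / (n : ℝ) ^ β) ^ (s / (s + β)) + R +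
        (σ p).toReal / (n : ℝ) ^ s)) := by
  have hp0 : 0 < p := by linarith [hp.1]
  have hs0 : 0 ≤ s := by
    rw [hs, sub_nonneg, div_le_one hp0]; exact hp.1
  have hs1 : s ≤ 1 := by
    rw [hs, sub_le_self_iff]; positivity
  refine le_of_forall_pieces hn hκ hs0 hs1 hβ0 ENNReal.toReal_nonneg hL hR fun k hk => ?_
  -- The degree is three times the `4 * k` affine functions.
  have hl : lossToClass x f (extremalSet x (monoConvexConcave a b) (12 * k)) ≤
      ENNReal.ofReal (24 * (L / (k : ℝ) ^ β + R)) := by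
    rcases h k hk with h | h
    · exact lossToClass_le_of_affineApprox hx h (by omega)
    · exact lossToClass_le_of_affineApprox_neg hx h (by omega)
  have := riskBound_le_of_lossToClass hn hκ hp hσ (by omega) (by positivity) hl
  rw [← hs] at this
  refine this.trans_eq ?_
  congr 1
  ring

lemma AffineApprox.mono {n : ℕ} {x : Fin n → ℝ} {f : ℝ → ℝ} {m : ℕ} {ε ε' : ℝ}
    (h : AffineApprox x f m ε) (hε : ε ≤ ε') : AffineApprox x f m ε' := by
  obtain ⟨S, hS, h1, h2, h3⟩ := h
  exact ⟨S, hS, h1, h2, h3.trans hε⟩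

end ShapeRegression

/-! ### The corollary. -/

theorem mainTheorem8 (κ : ℝ) (hκ : 0 < κ) :
    ∃ C : ℝ, 0 < C ∧
      ∀ (Ω : Type*) [MeasurableSpace Ω] (P : MeasureTheory.Measure Ω)
        [MeasureTheory.IsProbabilityMeasure P]
        (n : ℕ) (_ : 0 < n) (a b : ℝ) (_ : a < b)
        (x : Fin n → ℝ) (_ : ∀ i, x i ∈ Set.Icc a b)
        (f : ℝ → ℝ) (_ : f ∈ ShapeRegression.monoConvexConcave a b)
        (Y : Fin n → Ω → ℝ) (_ : ShapeRegression.IsRegressionModel P x f Y)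
        (σ : ℝ → ENNReal)
        (_ : ∀ q ∈ Set.Icc (1 : ℝ) 2, ShapeRegression.errorMoment P Y q ≤ σ q)
        (p : ℝ) (_ : p ∈ Set.Icc (1 : ℝ) 2) (_ : σ p ≠ ⊤)
        (s : ℝ) (_ : s = 1 - 1 / p),
        (ShapeRegression.derivVariation f a b ≠ ⊤ →
          ShapeRegression.riskBound κ σ x (ShapeRegression.monoConvexConcave a b) f ≤
            ENNReal.ofReal (C *
              ((σ p).toReal ^ (2 / (s + 2)) *
                  ((ShapeRegression.derivVariation f a b).toReal * (b - a) / (n : ℝ) ^ 2) ^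
                    (s / (s + 2)) +
                (σ p).toReal / (n : ℝ) ^ s))) ∧
        (∀ (w : ℝ → ℝ) (A α : ℝ), 1 ≤ A → 0 < α → α ≤ 1 →
          ShapeRegression.IsModulus (ShapeRegression.designMeasure x) w →
          (∀ u, 0 ≤ u → w u = w 0 + A * (u / (b - a)) ^ α) →
          ∀ β : ℝ, β = ShapeRegression.rateExponent α →
          (1 < β ∧ β ≤ 2) ∧
          ShapeRegression.riskBound κ σ x (ShapeRegression.monoConvexConcave a b) f ≤
            ENNReal.ofReal (C *
              ((σ p).toReal ^ (β / (s + β)) *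
                  (ShapeRegression.modulusConst α A * |f a - f b| / (n : ℝ) ^ β) ^
                    (s / (s + β)) +
                |f a - f b| * w 0 +
                (σ p).toReal / (n : ℝ) ^ s))) := by
  classical
  open ShapeRegression in
  refine ⟨144 + 24 * κ, by positivity, ?_⟩
  intro Ω _ P _ n hn a b hab x hx f hf Y _ σ _ p hp hσ s hs
  refine ⟨fun hV => ?_, fun w A α hA h0 h1 hw hwform β hβ => ?_⟩
  · have hba : 0 < b - a := sub_pos.2 hab
    have key := riskBound_le_of_approx hn hκ.le hx (f := f) hp hσ hs (β := 2)
      (L := (derivVariation f a b).toReal * (b - a)) (R := 0) (by norm_num)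
      (by positivity) le_rfl fun k hk => ?_
    · simpa using key
    · have hle : (derivVariation f a b).toReal * (b - a) / (k : ℝ) ^ 2 ≤
          24 * ((derivVariation f a b).toReal * (b - a) / (k : ℝ) ^ (2 : ℝ) + 0) := by
        have h2 : 0 ≤ (derivVariation f a b).toReal * (b - a) / (k : ℝ) ^ 2 := by positivity
        rw [Real.rpow_two]
        linarith
      rcases hf.2.2 with hv | hv
      · obtain ⟨c, d, hc, hd, hW⟩ := exists_isSubgradient_endpoints hv hV
        exact Or.inl ((affineApprox_of_derivVariation hn hab hx hv hf.2.1 hc hd hW hk).mono hle)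
      · obtain ⟨c, d, hc, hd, hW⟩ := exists_isSubgradient_endpoints_neg hv hV
        exact Or.inr ((affineApprox_of_derivVariation hn hab hx hv.neg
          (neg_mem_monoConvexConcave hf).2.1 hc hd hW hk).mono hle)
  · have hb := rateExponent_bounds h0 h1
    rw [← hβ] at hb
    have hω : 0 ≤ w 0 := hw.nonneg 0 le_rfl
    have hA0 : 0 < A := by linarith
    have hc : 0 ≤ modulusConst α A := by unfold modulusConst; positivity
    -- The modulus is used only on intervals that end at `b` or start at `a`, where a monotone
    -- convex function can be steep.
    have hQb : ∀ t ∈ Set.Icc a b, ((Finset.univ.filter fun i => t ≤ x i).card : ℝ) ≤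
        n * (w 0 + A * ((b - t) / (b - a)) ^ α) := by
      intro t ht
      have := card_le_of_isModulus hn hw (Set.ordConnected_Icc (a := t) (b := b))
        (Metric.isBounded_Icc t b)
      rw [Real.volume_Icc, ENNReal.toReal_ofReal (sub_nonneg.2 ht.2),
        hwform _ (sub_nonneg.2 ht.2)] at this
      simpa [(hx _).2] using this
    have hQa : ∀ t ∈ Set.Icc a b, ((Finset.univ.filter fun i => x i ≤ t).card : ℝ) ≤
        n * (w 0 + A * ((t - a) / (b - a)) ^ α) := by
      intro t ht
      have := card_le_of_isModulus hn hw (Set.ordConnected_Icc (a := a) (b := t))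
        (Metric.isBounded_Icc a t)
      rw [Real.volume_Icc, ENNReal.toReal_ofReal (sub_nonneg.2 ht.1),
        hwform _ (sub_nonneg.2 ht.1)] at this
      simpa [(hx _).1] using this
    refine ⟨hb, riskBound_le_of_approx hn hκ.le hx hp hσ hs hb.1.le (by positivity)
      (by positivity) fun k hk => ?_⟩
    have hle : 24 * (modulusConst α A * |f a - f b| / (k : ℝ) ^ rateExponent α) +
        2 * |f a - f b| * w 0 ≤
        24 * (modulusConst α A * |f a - f b| / (k : ℝ) ^ β + |f a - f b| * w 0) := by
      have : 0 ≤ |f a - f b| * w 0 := by positivity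
      rw [← hβ]
      linarith
    rcases hf.2.2 with hv | hv
    · exact Or.inl ((affineApprox_of_modulus hn hab hx hv hf.2.1 hω hA0 h0 h1 hQb hQa hk).mono hle)
    · have := affineApprox_of_modulus hn hab hx hv.neg (neg_mem_monoConvexConcave hf).2.1 hω hA0 h0
        h1 hQb hQa hk
      rw [show |(-f) a - (-f) b| = |f a - f b| by
        rw [← abs_neg]; simp only [Pi.neg_apply]; ring_nf] at this
      exact Or.inr (this.mono hle)
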